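/- Let $\Sigma$ be a finite nonempty alphabet. For $k\ge 0$, a language over $\Sigma$ is $k$-piecewise testable ($k$-PT) if it is a finite boolean combination of languages of the form $\Sigma^* a_1\Sigma^* a_2\Sigma^*\cdots\Sigma^* a_\ell\Sigma^*$ with $0\le \ell\le k$ and $a_i\in\Sigma$. A (complete) DFA $\mathcal A=(Q,\Sigma,\cdot,i,F)$ with $Q$ finite is minimal if all its states are reachable from $i$ and pairwise distinguishable; it is partially ordered if its reachability relation on $Q$ is a partial order; and it is confluent if for every $\Gamma\subseteq\Sigma$, every $q\in Q$ and all $u,v\in\Gamma^*$ there is $w\in\Gamma^*$ with $(q\cdot u)\cdot w=(q\cdot v)\cdot w$. Proposition (finding the minimal $k$). There are a deterministic multi-stack (equivalently, multi-tape) Turing machine $T$, a polynomial $p$ and a constant $c$ such that the following holds for every minimal, partially ordered and confluent DFA $\mathcal A$ with $n$ states and $m\ge 1$ letters: there is a least $k\ge 0$ such that $L(\mathcal A)$ is $k$-PT, and on input (a standard binary string code of the transition table, initial state and accepting states of) $\mathcal A$, the machine $T$ halts with output $k$ (in unary) after at most $$2^{p(n+m)}\cdot 2^{2^{ck}}$$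 steps; that is, the minimal $k$ is computed in time exponential in the size of $\mathcal A$ and doubly exponential in the resulting $k$. -/

import Mathlib

/-!
Deterministic finite automata are Mathlib's `DFA`, languages are Mathlib's `Language`, and the
machine model is Mathlib's finite multi-stack Turing machine `Turing.FinTM2` with its step count.
-/

namespace PTAutomata

section Languages

variable {α : Type*}

/-- The language `Σ* a₁ Σ* a₂ Σ* ⋯ Σ* aₙ Σ*` of the word `a₁ a₂ ⋯ aₙ`
(here `⊤` is the language `Σ*` of all words). -/
def subwordLanguage : List α → Language α
  | [] => ⊤
  | a :: v => ⊤ * ({[a]} : Language α) * subwordLanguage v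

/-- `L` is `k`-piecewise testable: it is a finite boolean combination of languages
`Σ* a₁ Σ* ⋯ Σ* aₙ Σ*` with `0 ≤ n ≤ k`, i.e. it lies in the boolean algebra that they generate. -/
def IsPiecewiseTestable (k : ℕ) (L : Language α) : Prop :=
  L ∈ BooleanSubalgebra.closure {K : Language α | ∃ v : List α, v.length ≤ k ∧ K = subwordLanguage v}

end Languages

section Automata

variable {α σ : Type*}

/-- The reachability relation: `p ≤ q` if some word leads from `p` to `q`. -/
def Reaches (M : DFA α σ) (p q : σ) : Prop :=
  ∃ w : List α, M.evalFrom p w = q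

/-- The states `p` and `q` are distinguishable: some word is accepted from exactly one of them. -/
def Distinguishable (M : DFA α σ) (p q : σ) : Prop :=
  ∃ w : List α, ¬(M.evalFrom p w ∈ M.accept ↔ M.evalFrom q w ∈ M.accept)

/-- A DFA is minimal if all states are reachable and pairwise distinguishable. -/
def IsMinimal (M : DFA α σ) : Prop :=
  (∀ q, Reaches M M.start q) ∧ ∀ p q, p ≠ q → Distinguishable M p q

/-- A DFA is partially ordered if its reachability relation is a partial order. -/
def IsPartiallyOrdered (M : DFA α σ) : Prop :=
  IsPartialOrder σ (Reaches M)

/-- `Γ`-confluence, for a subalphabet `Γ`: whenever `u, v ∈ Γ*`, there is a `w ∈ Γ*` with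
`(q u) w = (q v) w`. -/
def IsConfluentOn (M : DFA α σ) (Γ : Set α) : Prop :=
  ∀ (q : σ) (u v : List α), (∀ a ∈ u, a ∈ Γ) → (∀ a ∈ v, a ∈ Γ) →
    ∃ w : List α, (∀ a ∈ w, a ∈ Γ) ∧
      M.evalFrom (M.evalFrom q u) w = M.evalFrom (M.evalFrom q v) w

/-- A DFA is confluent if it is `Γ`-confluent for every subalphabet `Γ`. -/
def IsConfluent (M : DFA α σ) : Prop :=
  ∀ Γ : Set α, IsConfluentOn M Γ

end Automata

section Coding

/-- Self-delimiting code of a natural number: `i` times the bit `1`, then the bit `0`. -/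
def codeNat (i : ℕ) : List Bool :=
  List.replicate i true ++ [false]

open Classical in
/-- The input word that describes a DFA with states `0, …, n - 1` and letters `0, …, m - 1`:
first `n`, `m` and the initial state; then, for each state `q`, one bit that tells whether `q` is
accepting, followed by the successors of `q` under the letters `0, …, m - 1`. -/
noncomputable def codeDFA {n m : ℕ} (M : DFA (Fin m) (Fin n)) : List Bool :=
  codeNat n ++ codeNat m ++ codeNat M.start ++
    (List.finRange n).flatMap fun q =>
      decide (q ∈ M.accept) :: (List.finRange m).flatMap fun a => codeNat (M.step q a)

/-- The machine `T`, started on the input word `x`, halts with output word `y` after at most `t`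
steps. -/
def HaltsWithOutput (T : Turing.TM2ComputableAux Bool Bool) (x y : List Bool) (t : ℕ) : Prop :=
  Nonempty (Turing.TM2OutputsInTime T.tm (x.map T.inputAlphabet.symm)
    (some (y.map T.outputAlphabet.symm)) t)

end Coding

end PTAutomata

/-!
Let `u ~_k v` mean that `u` and `v` have the same subwords of length at most `k`. A language is
`k`-piecewise testable exactly if it is a union of `~_k`-classes, and for a minimal automaton this
says that `~_k`-equivalent words lead to the same state (`IsMinimal.isPiecewiseTestable_iff`).

The relation `~_k` is generated by insertions of single letters (`eq_of_subEquiv`), and inserting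
`a` between `x` and `y` preserves the class exactly if the depths of `a` in `x` and in `y` add up
to at least `k` (`subEquiv_insert_iff`). In a partially ordered automaton with `n` states, a
letter that changes the state reached by `x` has depth less than `n` in `x`, since every increase
of the depth is paid for by a change of the state (`IsPartiallyOrdered.appendDepth_add_rank_le`).
If the automaton is also confluent, then a word in which `a` has depth `2 n` merges the states `p`
and `p a`: along each of its arches one of two states changes, or else confluence makes them equal
(`IsConfluent.evalFrom_eq`). Hence the language is `3 n`-piecewise testable, and the least `k`
exists and is at most `3 n`. Moreover, if the language is not `k`-piecewise testable, then this is
witnessed by an insertion whose two contexts can be thinned out to polynomial length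
(`IsConfluent.eval_eq_of_short`).

The machine therefore tests `k = 0, 1, 2, …` by brute force over all pairs of words of polynomial
length, of which there are `2 ^ poly(n + m)`. To bound its running time, words and the code of the
automaton are treated as natural numbers held in unary on the stacks. The functions `f` that a
register program computes in time `2 ^ ℓ ^ c` from arguments of size at most `2 ^ ℓ` contain the
arithmetic operations and are closed under composition, bounded recursion, bounded search and
bounded quantification (`QPComputable`), and every function of this class yields a stack machine
that works in time `2 ^ poly` of the length of its input (`QPComputable.exists_machine`). As the
code of the automaton has polynomial length, the claimed bound holds even without its doubly
exponential factor, which is therefore used with the constant `0`.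
-/

namespace PTAutomata

/-! ### Subwords and the congruences `~_k` -/

section Words

variable {α : Type*}

theorem mem_subwordLanguage {v u : List α} : u ∈ subwordLanguage v ↔ v.Sublist u := by
  induction v generalizing u with
  | nil => exact ⟨fun _ => u.nil_sublist, fun _ => Set.mem_univ u⟩
  | cons a v ih =>
    simp only [subwordLanguage, Language.mem_mul]
    constructor
    · rintro ⟨x, ⟨y, -, z, hz, rfl⟩, w, hw, rfl⟩
      obtain rfl : z = [a] := hz
      rw [List.append_assoc]
      exact ((ih.1 hw).cons_cons a).trans (List.sublist_append_right y _)
    · intro h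
      obtain ⟨y, w, rfl, hy, hw⟩ := List.cons_sublist_iff.1 h
      obtain ⟨y₁, y₂, rfl⟩ := List.append_of_mem hy
      exact ⟨y₁ ++ [a], ⟨y₁, Set.mem_univ _, [a], rfl, rfl⟩, y₂ ++ w,
        ih.2 (hw.trans (List.sublist_append_right _ _)), by simp⟩

/-- `u ~_k v`: the words `u` and `v` have the same subwords of length at most `k`. -/
def SubEquiv (k : ℕ) (u v : List α) : Prop :=
  ∀ z : List α, z.length ≤ k → (z.Sublist u ↔ z.Sublist v)

theorem SubEquiv.symm {k : ℕ} {u v : List α} (h : SubEquiv k u v) : SubEquiv k v u :=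
  fun z hz => (h z hz).symm

theorem SubEquiv.trans {k : ℕ} {u v w : List α} (h : SubEquiv k u v) (h' : SubEquiv k v w) :
    SubEquiv k u w :=
  fun z hz => (h z hz).trans (h' z hz)

/-- A word with a marked letter that embeds into `p ++ q` embeds its part up to the marked letter
into `p` or its part from the marked letter on into `q`. -/
theorem sublist_append_split {z w p q : List α} {a : α} (h : (z ++ a :: w).Sublist (p ++ q)) :
    (z ++ [a]).Sublist p ∨ (a :: w).Sublist q := by
  obtain ⟨l₁, l₂, hl, h₁, h₂⟩ := List.sublist_append_iff.1 h
  rcases List.append_eq_append_iff.1 hl with ⟨c, rfl, hc⟩ | ⟨c, rfl, hc⟩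
  · cases c with
    | nil => simp only [List.nil_append] at hc; exact Or.inr (hc ▸ h₂)
    | cons b c =>
      obtain ⟨rfl, -⟩ := List.cons.inj hc
      exact Or.inl ((List.Sublist.append_left (by simp) z).trans h₁)
  · exact Or.inr (((List.sublist_append_right c _)).trans (hc ▸ h₂))

theorem append_singleton_sublist {z p : List α} {a b : α} (hab : a ≠ b)
    (h : (z ++ [a]).Sublist (p ++ [b])) : (z ++ [a]).Sublist p := by
  rcases sublist_append_split h with h | h
  · exact h
  · simp [hab] at h

variable [DecidableEq α]

/-- The length of a shortest subword `z` of `y` such that `a z` is not a subword of `y`;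
equivalently, the largest `r` with `a y ~_r y`. -/
def prependDepth : List α → α → ℕ
  | [], _ => 0
  | b :: y, a =>
    if a = b then prependDepth y b + 1 else min (prependDepth y a) (prependDepth y b + 1)

/-- The length of a shortest subword `z` of `x` such that `z a` is not a subword of `x`;
equivalently, the largest `l` with `x a ~_l x`. -/
def appendDepth (x : List α) (a : α) : ℕ :=
  prependDepth x.reverse a

theorem prependDepth_cons_self (b : α) (y : List α) :
    prependDepth (b :: y) b = prependDepth y b + 1 := by
  simp [prependDepth]

theorem prependDepth_cons_of_ne {a b : α} (h : a ≠ b) (y : List α) :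
    prependDepth (b :: y) a = min (prependDepth y a) (prependDepth y b + 1) := by
  simp [prependDepth, h]

theorem prependDepth_cons_le (a b : α) (y : List α) :
    prependDepth (b :: y) a ≤ prependDepth y b + 1 := by
  by_cases h : a = b
  · rw [h, prependDepth_cons_self]
  · rw [prependDepth_cons_of_ne h]
    exact min_le_right _ _

theorem min_le_prependDepth_cons (a b : α) (y : List α) :
    min (prependDepth y a) (prependDepth y b) ≤ prependDepth (b :: y) a := by
  by_cases h : a = b
  · rw [h, prependDepth_cons_self]
    omega
  · rw [prependDepth_cons_of_ne h]
    omega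

theorem cons_sublist_of_length_lt {y z : List α} {a : α} (h : z.Sublist y)
    (hl : z.length < prependDepth y a) : (a :: z).Sublist y := by
  induction y generalizing z a with
  | nil => simp [prependDepth] at hl
  | cons b y ih =>
    by_cases hab : a = b
    · subst hab
      rw [prependDepth_cons_self] at hl
      refine List.Sublist.cons_cons a ?_
      cases h with
      | cons _ h => exact h
      | cons_cons _ h => exact ih h (by simpa using hl)
    · rw [prependDepth_cons_of_ne hab] at hl
      refine List.Sublist.cons b ?_
      cases h with
      | cons _ h => exact ih h (by omega)
      | cons_cons _ h =>
        rename_i z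
        simp only [List.length_cons] at hl
        exact ih (ih h (by omega)) (by simp only [List.length_cons]; omega)

theorem exists_not_cons_sublist (y : List α) (a : α) :
    ∃ z : List α, z.Sublist y ∧ z.length = prependDepth y a ∧ ¬(a :: z).Sublist y := by
  induction y generalizing a with
  | nil => exact ⟨[], by simp [prependDepth]⟩
  | cons b y ih =>
    by_cases hab : a = b
    · subst hab
      obtain ⟨z, h₁, h₂, h₃⟩ := ih a
      exact ⟨a :: z, h₁.cons_cons a, by simp [prependDepth_cons_self, h₂],
        fun h => h₃ (List.cons_sublist_cons.1 h)⟩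
    · rw [prependDepth_cons_of_ne hab]
      rcases le_total (prependDepth y a) (prependDepth y b + 1) with hle | hle
      · obtain ⟨z, h₁, h₂, h₃⟩ := ih a
        refine ⟨z, h₁.cons b, by simp [h₂, hle], fun h => h₃ ?_⟩
        cases h with
        | cons _ h => exact h
        | cons_cons _ h => exact absurd rfl hab
      · obtain ⟨z, h₁, h₂, h₃⟩ := ih b
        refine ⟨b :: z, h₁.cons_cons b, by simp [h₂, hle], fun h => h₃ ?_⟩
        cases h with
        | cons _ h => exact (List.sublist_cons_self a _).trans h
        | cons_cons _ h => exact absurd rfl hab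

theorem append_sublist_of_length_lt {x z : List α} {a : α} (h : z.Sublist x)
    (hl : z.length < appendDepth x a) : (z ++ [a]).Sublist x := by
  have := cons_sublist_of_length_lt (a := a) h.reverse (by simpa [appendDepth] using hl)
  rw [← List.reverse_sublist]; simpa using this

theorem exists_not_append_sublist (x : List α) (a : α) :
    ∃ z : List α, z.Sublist x ∧ z.length = appendDepth x a ∧ ¬(z ++ [a]).Sublist x := by
  obtain ⟨z, h₁, h₂, h₃⟩ := exists_not_cons_sublist x.reverse a
  refine ⟨z.reverse, List.reverse_sublist.1 (by simpa using h₁), by simpa [appendDepth] using h₂,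
    fun h => h₃ ?_⟩
  rw [← List.reverse_sublist] at h; simpa using h

theorem appendDepth_append_singleton_of_ne {a b : α} (h : a ≠ b) (x : List α) :
    appendDepth (x ++ [b]) a = min (appendDepth x a) (appendDepth x b + 1) := by
  simp [appendDepth, prependDepth_cons_of_ne h]

/-- Inserting the letter `a` between `x` and `y` preserves the `~_k`-class exactly if the depths on
both sides add up to at least `k`. -/
theorem subEquiv_insert_iff {k : ℕ} {x y : List α} {a : α} :
    SubEquiv k (x ++ a :: y) (x ++ y) ↔ k ≤ appendDepth x a + prependDepth y a := by
  constructor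
  · intro h
    by_contra! hk
    obtain ⟨z, hz, hzl, hza⟩ := exists_not_append_sublist x a
    obtain ⟨w, hw, hwl, haw⟩ := exists_not_cons_sublist y a
    have := (h (z ++ a :: w) (by simp; omega)).1 (hz.append (hw.cons_cons a))
    rcases sublist_append_split this with h' | h'
    exacts [hza h', haw h']
  · intro hk t ht
    refine ⟨fun h => ?_, fun h => h.trans (List.Sublist.append_left (by simp) x)⟩
    obtain ⟨z, l₂, rfl, hz, h₂⟩ := List.sublist_append_iff.1 h
    cases h₂ with
    | cons _ h₂ => exact hz.append h₂
    | cons_cons _ h₂ =>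
      rename_i w
      simp only [List.length_append, List.length_cons] at ht
      rcases lt_or_ge z.length (appendDepth x a) with hl | hl
      · simpa using (append_sublist_of_length_lt hz hl).append h₂
      · exact hz.append (cons_sublist_of_length_lt h₂ (by omega))

/-- If two `~_k`-equivalent words differ first after the common prefix `p`, then the letter that
`p` absorbs better can be inserted into the other word without leaving the `~_k`-class. -/
theorem le_depth_of_subEquiv {k : ℕ} {p s t : List α} {a b : α} (hab : a ≠ b)
    (h : SubEquiv k (p ++ a :: s) (p ++ b :: t)) (hd : appendDepth p a ≤ appendDepth p b) :
    k ≤ appendDepth p b + prependDepth (a :: s) b := by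
  by_contra! hk
  obtain ⟨z, hz, hzl, hzb⟩ := exists_not_append_sublist p b
  obtain ⟨u, hu, hul, hua⟩ := exists_not_append_sublist p a
  obtain ⟨w, hw, hwl, hbw⟩ := exists_not_cons_sublist (a :: s) b
  have hua' : ¬(u ++ [a]).Sublist (p ++ [b]) := fun h' => hua (append_singleton_sublist hab h')
  have key : w.Sublist t := by
    cases hw with
    | cons _ hw =>
      have := (h (u ++ a :: w) (by simp; omega)).1 (hu.append (hw.cons_cons a))
      rw [List.append_cons p b t] at this
      rcases sublist_append_split this with h' | h'
      · exact absurd h' hua'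
      · exact (List.sublist_cons_self a w).trans h'
    | cons_cons _ hw =>
      rename_i w
      simp only [List.length_cons] at hwl
      have := (h (u ++ a :: w) (by simp; omega)).1 (hu.append (hw.cons_cons a))
      rw [List.append_cons p b t] at this
      rcases sublist_append_split this with h' | h'
      · exact absurd h' hua'
      · exact h'
  have := (h (z ++ b :: w) (by simp; omega)).2 (hz.append (key.cons_cons b))
  rcases sublist_append_split this with h' | h'
  exacts [hzb h', hbw h']

/-- The congruence `~_k` is generated by the insertions of single letters: a function on words that
does not notice the insertions within `~_k`-classes is constant on the `~_k`-classes. -/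
theorem eq_of_subEquiv {β : Type*} {k : ℕ} (φ : List α → β)
    (hφ : ∀ x y a, k ≤ appendDepth x a + prependDepth y a → φ (x ++ a :: y) = φ (x ++ y))
    {u v : List α} (h : SubEquiv k u v) : φ u = φ v := by
  suffices H : ∀ N, ∀ p s t : List α, s.length + t.length ≤ N →
      SubEquiv k (p ++ s) (p ++ t) → φ (p ++ s) = φ (p ++ t) from H _ [] u v le_rfl h
  have squeeze : ∀ (p : List α) (b : α) (t : List α), SubEquiv k p (p ++ b :: t) →
      SubEquiv k (p ++ [b]) p := fun p b t h z hz =>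
    ⟨fun h' => (h z hz).2 (h'.trans (List.Sublist.append_left (by simp) p)),
      fun h' => h'.trans (List.sublist_append_left p _)⟩
  intro N
  induction N with
  | zero =>
    intro p s t hN _
    obtain ⟨rfl, rfl⟩ : s = [] ∧ t = [] :=
      ⟨List.length_eq_zero_iff.1 (by omega), List.length_eq_zero_iff.1 (by omega)⟩
    rfl
  | succ N ih =>
    intro p s t hN h
    match s, t with
    | [], [] => rfl
    | [], b :: t =>
      rw [List.append_nil] at h ⊢
      have h' := squeeze p b t h
      have h₁ := hφ p [] b (subEquiv_insert_iff.1 (by simpa using h'))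
      rw [List.append_nil] at h₁
      rw [← h₁, List.append_cons]
      simpa using ih (p ++ [b]) [] t (by simp at hN ⊢; omega) (by simpa using h'.trans h)
    | a :: s, [] =>
      rw [List.append_nil] at h ⊢
      have h' := squeeze p a s h.symm
      have h₁ := hφ p [] a (subEquiv_insert_iff.1 (by simpa using h'))
      rw [List.append_nil] at h₁
      rw [← h₁, List.append_cons]
      simpa using ih (p ++ [a]) s [] (by simp at hN ⊢; omega) (by simpa using h.trans h'.symm)
    | a :: s, b :: t =>
      by_cases hab : a = b
      · subst hab
        rw [List.append_cons p a s, List.append_cons p a t] at h ⊢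
        exact ih _ s t (by simp at hN; omega) h
      · rcases le_total (appendDepth p a) (appendDepth p b) with hd | hd
        · have hk := le_depth_of_subEquiv hab h hd
          rw [← hφ p (a :: s) b hk, List.append_cons p b (a :: s), List.append_cons p b t]
          refine ih _ _ _ (by simp at hN ⊢; omega) ?_
          simpa using (subEquiv_insert_iff.2 hk).trans h
        · have hk := le_depth_of_subEquiv (Ne.symm hab) h.symm hd
          rw [← hφ p (b :: t) a hk, List.append_cons p a (b :: t), List.append_cons p a s]
          refine ih _ _ _ (by simp at hN ⊢; omega) ?_
          simpa using h.trans (subEquiv_insert_iff.2 hk).symm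

/-! ### Arch factorizations -/

theorem prependDepth_append_le {y₁ y₂ : List α} {a : α} (h : a ∉ y₁) :
    prependDepth (y₁ ++ y₂) a ≤ prependDepth y₂ a := by
  induction y₁ with
  | nil => simp
  | cons b y₁ ih =>
    simp only [List.mem_cons, not_or] at h
    rw [List.cons_append, prependDepth_cons_of_ne h.1]
    exact (min_le_left _ _).trans (ih h.2)

/-- If all letters of `Γ` have depth more than `r` in `y`, then `y` has a prefix that contains all
letters of `Γ` and whose letters have depth at least `r` in the rest of `y`. -/
theorem exists_arch {r : ℕ} {y : List α} {Γ : Set α} (h : ∀ c ∈ Γ, r < prependDepth y c) :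
    ∃ y₁ y₂, y = y₁ ++ y₂ ∧ (∀ c ∈ Γ, c ∈ y₁) ∧ ∀ c ∈ y₁, r ≤ prependDepth y₂ c := by
  induction y generalizing Γ with
  | nil =>
    refine ⟨[], [], rfl, fun c hc => ?_, by simp⟩
    have := h c hc
    simp [prependDepth] at this
  | cons b y ih =>
    by_cases hΓ : ∃ c, c ∈ Γ
    · obtain ⟨c₀, hc₀⟩ := hΓ
      obtain ⟨y₁, y₂, rfl, h₁, h₂⟩ := ih (Γ := Γ \ {b}) fun c hc => by
        have := h c hc.1
        rw [prependDepth_cons_of_ne (by simpa using hc.2)] at this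
        omega
      have hb : r ≤ prependDepth (y₁ ++ y₂) b := by
        have := h c₀ hc₀
        have := prependDepth_cons_le c₀ b (y₁ ++ y₂)
        omega
      refine ⟨b :: y₁, y₂, rfl, fun c hc => ?_, fun c hc => ?_⟩
      · by_cases hcb : c = b
        · simp [hcb]
        · exact List.mem_cons_of_mem b (h₁ c ⟨hc, hcb⟩)
      · by_cases hcy : c ∈ y₁
        · exact h₂ c hcy
        · obtain rfl : c = b := by simpa [hcy] using hc
          exact hb.trans (prependDepth_append_le hcy)
    · exact ⟨[], b :: y, rfl, fun c hc => absurd ⟨c, hc⟩ hΓ, by simp⟩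

theorem le_prependDepth_append {r : ℕ} {y₁ y₂ : List α} {b : α} (hb : r ≤ prependDepth y₂ b)
    (h : ∀ c ∈ y₁, r ≤ prependDepth y₂ c) : r ≤ prependDepth (y₁ ++ y₂) b := by
  induction y₁ generalizing b with
  | nil => simpa
  | cons d y₁ ih =>
    refine le_trans (le_min (ih hb ?_) (ih (h d (by simp)) ?_)) (min_le_prependDepth_cons b d _)
    all_goals exact fun c hc => h c (List.mem_cons_of_mem d hc)

/-- Converse of `exists_arch`. -/
theorem lt_prependDepth_append {r : ℕ} {y₁ y₂ : List α} (h : ∀ c ∈ y₁, r ≤ prependDepth y₂ c)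
    {c : α} (hc : c ∈ y₁) : r < prependDepth (y₁ ++ y₂) c := by
  induction y₁ with
  | nil => simp at hc
  | cons b y₁ ih =>
    have h' : ∀ c ∈ y₁, r ≤ prependDepth y₂ c := fun c hc => h c (List.mem_cons_of_mem b hc)
    have hb := le_prependDepth_append (h b (by simp)) h'
    by_cases hcb : c = b
    · subst hcb
      rw [List.cons_append, prependDepth_cons_self]
      omega
    · rw [List.cons_append, prependDepth_cons_of_ne hcb]
      have := ih h' (by simpa [hcb] using hc)
      omega

end Words

/-! ### Piecewise testability through `~_k` -/

section Piecewise

variable {α σ : Type*} {M : DFA α σ}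

theorem evalFrom_append (p : σ) (u v : List α) :
    M.evalFrom p (u ++ v) = M.evalFrom (M.evalFrom p u) v :=
  M.evalFrom_of_append p u v

/-- Piecewise testability in terms of the congruences `~_k`. -/
theorem isPiecewiseTestable_iff [Finite α] {k : ℕ} {L : Language α} :
    IsPiecewiseTestable k L ↔ ∀ u v : List α, SubEquiv k u v → u ∈ L → v ∈ L := by
  classical
  constructor
  · intro h u v huv
    suffices H : u ∈ L ↔ v ∈ L from H.1
    induction h using BooleanSubalgebra.closure_bot_sup_induction with
    | mem K hK =>
      obtain ⟨z, hz, rfl⟩ := hK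
      rw [mem_subwordLanguage, mem_subwordLanguage]
      exact huv z hz
    | bot => exact Iff.rfl
    | sup K _ K' _ h h' => exact or_congr h h'
    | compl K _ h => exact not_congr h
  · intro h
    set A := BooleanSubalgebra.closure
      {K : Language α | ∃ v : List α, v.length ≤ k ∧ K = subwordLanguage v} with hA
    have hfin : Set.Finite {z : List α | z.length ≤ k} := List.finite_length_le α k
    let F : Finset (List α) := hfin.toFinset
    have hF : ∀ z, z ∈ F ↔ z.length ≤ k := fun z => by simp [F]
    -- the `~_k`-class of the words whose short subwords are those in `S`
    let cls : Finset (List α) → Language α := fun S =>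
      F.inf fun z => if z ∈ S then subwordLanguage z else (subwordLanguage z)ᶜ
    have hcls : ∀ S, cls S ∈ A := fun S =>
      Finset.inf_induction (p := (· ∈ A)) BooleanSubalgebra.top_mem
        (fun _ h _ h' => BooleanSubalgebra.inf_mem h h') fun z hz => by
        have : subwordLanguage z ∈ A :=
          BooleanSubalgebra.subset_closure ⟨z, (hF z).1 hz, rfl⟩
        split_ifs
        exacts [this, BooleanSubalgebra.compl_mem this]
    have hmem : ∀ S v, v ∈ cls S ↔ ∀ z ∈ F, (z ∈ S ↔ z.Sublist v) := by
      intro S v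
      have : ∀ G : Finset (List α), v ∈ (G.inf fun z => if z ∈ S then subwordLanguage z
          else (subwordLanguage z)ᶜ) ↔ ∀ z ∈ G, (z ∈ S ↔ z.Sublist v) := by
        intro G
        induction G using Finset.induction_on with
        | empty => exact ⟨fun _ => by simp, fun _ => Set.mem_univ v⟩
        | insert z G hz ih =>
          rw [Finset.inf_insert, Finset.forall_mem_insert]
          refine and_congr ?_ ih
          split_ifs with hzS
          · simp only [hzS, true_iff]
            exact mem_subwordLanguage
          · simp only [hzS, false_iff]
            exact not_congr mem_subwordLanguage
      exact this F
    let pat : List α → Finset (List α) := fun u => F.filter (·.Sublist u)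
    have hL : L = ((F.powerset.filter fun S => ∃ u ∈ L, S = pat u).sup cls) := by
      ext v
      have : ∀ G : Finset (Finset (List α)), v ∈ G.sup cls ↔ ∃ S ∈ G, v ∈ cls S := by
        intro G
        induction G using Finset.induction_on with
        | empty => exact ⟨fun hv => (hv : False).elim, by simp⟩
        | insert S G hS ih =>
          rw [Finset.sup_insert, Finset.exists_mem_insert]
          exact or_congr Iff.rfl ih
      rw [this]
      constructor
      · intro hv
        exact ⟨pat v, by simpa [pat] using ⟨v, hv, rfl⟩,
          (hmem _ _).2 fun z hz => by simp [pat, hz]⟩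
      · rintro ⟨S, hS, hvS⟩
        obtain ⟨u, hu, rfl⟩ := (Finset.mem_filter.1 hS).2
        refine h u v (fun z hz => ?_) hu
        have := (hmem _ _).1 hvS z ((hF z).2 hz)
        simpa [pat, (hF z).2 hz] using this
    rw [IsPiecewiseTestable, ← hA, hL]
    exact Finset.sup_induction (p := (· ∈ A)) BooleanSubalgebra.bot_mem
      (fun _ h _ h' => BooleanSubalgebra.sup_mem h h') fun S _ => hcls S

/-- For a minimal automaton, piecewise testability of its language can be read off the states. -/
theorem IsMinimal.isPiecewiseTestable_iff [Finite α] (hM : IsMinimal M) {k : ℕ} :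
    IsPiecewiseTestable k M.accepts ↔
      ∀ u v : List α, SubEquiv k u v → M.eval u = M.eval v := by
  rw [PTAutomata.isPiecewiseTestable_iff]
  constructor
  · intro h u v huv
    by_contra hne
    obtain ⟨w, hw⟩ := hM.2 _ _ hne
    have key : ∀ u v : List α, SubEquiv k u v → SubEquiv k (u ++ w) (v ++ w) := by
      intro u v huv z hz
      simp only [List.sublist_append_iff]
      constructor
      · rintro ⟨l₁, l₂, rfl, h₁, h₂⟩
        exact ⟨l₁, l₂, rfl, (huv l₁ (by simp at hz; omega)).1 h₁, h₂⟩
      · rintro ⟨l₁, l₂, rfl, h₁, h₂⟩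
        exact ⟨l₁, l₂, rfl, (huv l₁ (by simp at hz; omega)).2 h₁, h₂⟩
    apply hw
    unfold DFA.eval
    rw [← evalFrom_append, ← evalFrom_append]
    exact ⟨h _ _ (key u v huv), h _ _ (key v u huv.symm)⟩
  · intro h u v huv hu
    have : M.eval v ∈ M.accept := h u v huv ▸ hu
    exact this

end Piecewise

/-! ### Partially ordered and confluent automata -/

section Automata

variable {α σ : Type*} {M : DFA α σ}

theorem Reaches.trans {p q r : σ} (h : Reaches M p q) (h' : Reaches M q r) : Reaches M p r := by
  obtain ⟨u, rfl⟩ := h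
  obtain ⟨v, rfl⟩ := h'
  exact ⟨u ++ v, M.evalFrom_of_append p u v⟩

theorem reaches_evalFrom (p : σ) (w : List α) : Reaches M p (M.evalFrom p w) :=
  ⟨w, rfl⟩

theorem reaches_step (p : σ) (a : α) : Reaches M p (M.step p a) :=
  ⟨[a], rfl⟩

theorem IsPartiallyOrdered.antisymm (hM : IsPartiallyOrdered M) {p q : σ} (h : Reaches M p q)
    (h' : Reaches M q p) : p = q :=
  have : IsPartialOrder σ (Reaches M) := hM
  antisymm_of (Reaches M) h h'

theorem evalFrom_eq_self {p : σ} {w : List α} (h : ∀ a ∈ w, M.step p a = p) :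
    M.evalFrom p w = p := by
  induction w with
  | nil => rfl
  | cons a w ih =>
    rw [DFA.evalFrom_cons, h a (by simp)]
    exact ih fun b hb => h b (List.mem_cons_of_mem a hb)

theorem IsPartiallyOrdered.step_eq_self (hM : IsPartiallyOrdered M) {p : σ} {w : List α}
    (h : M.evalFrom p w = p) {a : α} (ha : a ∈ w) : M.step p a = p := by
  induction w with
  | nil => simp at ha
  | cons b w ih =>
    rw [DFA.evalFrom_cons] at h
    have hb : M.step p b = p := hM.antisymm ⟨w, h⟩ (reaches_step p b)
    rw [hb] at h
    rcases List.mem_cons.1 ha with rfl | ha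
    exacts [hb, ih h ha]

/-- The number of states that are reachable from `p`. In a partially ordered automaton it drops
whenever the state changes. -/
noncomputable def rank (M : DFA α σ) (p : σ) : ℕ :=
  Set.ncard {q | Reaches M p q}

variable [Fintype σ]

theorem rank_pos (p : σ) : 0 < rank M p :=
  (Set.ncard_pos (Set.toFinite _)).2 ⟨p, [], rfl⟩

theorem rank_le_card (p : σ) : rank M p ≤ Fintype.card σ := by
  rw [← Nat.card_eq_fintype_card]
  exact Set.ncard_le_card _

theorem rank_le_of_reaches {p q : σ} (h : Reaches M p q) : rank M q ≤ rank M p :=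
  Set.ncard_le_ncard (fun _ hr => h.trans hr) (Set.toFinite _)

theorem IsPartiallyOrdered.rank_lt (hM : IsPartiallyOrdered M) {p q : σ} (h : Reaches M p q)
    (hne : q ≠ p) : rank M q < rank M p :=
  Set.ncard_lt_ncard ⟨fun _ hr => h.trans hr, fun hs =>
    hne (hM.antisymm (hs (show Reaches M p p from ⟨[], rfl⟩)) h)⟩ (Set.toFinite _)

variable [DecidableEq α]

/-- In a partially ordered automaton, a letter that changes the state reached by `x` has small depth
in `x`. -/
theorem IsPartiallyOrdered.appendDepth_add_rank_le (hM : IsPartiallyOrdered M) (p : σ)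
    {x : List α} {a : α} (h : M.evalFrom p (x ++ [a]) ≠ M.evalFrom p x) :
    appendDepth x a + rank M (M.evalFrom p x) ≤ Fintype.card σ := by
  induction x using List.reverseRecOn generalizing a with
  | nil => simpa [appendDepth, prependDepth] using rank_le_card p
  | append_singleton x b ih =>
    rw [DFA.evalFrom_append_singleton] at h
    by_cases hb : M.evalFrom p (x ++ [b]) = M.evalFrom p x
    · have hab : a ≠ b := by
        rintro rfl
        apply h
        rw [hb, ← DFA.evalFrom_append_singleton, hb]
      have := ih (a := a) (by rwa [DFA.evalFrom_append_singleton, ← hb])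
      rw [appendDepth_append_singleton_of_ne hab, hb]
      omega
    · have h₁ := ih hb
      have h₂ := hM.rank_lt (by rw [DFA.evalFrom_append_singleton]; exact reaches_step _ b) hb
      have h₃ : appendDepth (x ++ [b]) a ≤ appendDepth x b + 1 := by
        simpa [appendDepth] using prependDepth_cons_le a b x.reverse
      omega

/-- In a partially ordered confluent automaton, two states that are reachable from a common state by
words over `Γ` are merged by every word in which all letters of `Γ` have large depth: within one of
the arches of this word neither state changes, and then confluence makes them equal. -/
theorem IsConfluent.evalFrom_eq (hM : IsPartiallyOrdered M) (hC : IsConfluent M) {N : ℕ} {r : σ}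
    {Γ : Set α} {u v y : List α} (hu : ∀ a ∈ u, a ∈ Γ) (hv : ∀ a ∈ v, a ∈ Γ)
    (hN : rank M (M.evalFrom r u) + rank M (M.evalFrom r v) ≤ N)
    (hy : ∀ c ∈ Γ, N ≤ prependDepth y c) :
    M.evalFrom (M.evalFrom r u) y = M.evalFrom (M.evalFrom r v) y := by
  induction N generalizing u v y Γ with
  | zero => have := rank_pos (M := M) (M.evalFrom r u); omega
  | succ N ih =>
    obtain ⟨y₁, y₂, rfl, hΓ, hy₂⟩ := exists_arch hy
    have hu₁ : ∀ a ∈ u, a ∈ y₁ := fun a ha => hΓ a (hu a ha)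
    have hv₁ : ∀ a ∈ v, a ∈ y₁ := fun a ha => hΓ a (hv a ha)
    have hru := rank_le_of_reaches (reaches_evalFrom (M := M) (M.evalFrom r u) y₁)
    have hrv := rank_le_of_reaches (reaches_evalFrom (M := M) (M.evalFrom r v) y₁)
    by_cases hfix : M.evalFrom (M.evalFrom r u) y₁ = M.evalFrom r u ∧
        M.evalFrom (M.evalFrom r v) y₁ = M.evalFrom r v
    · obtain ⟨w, hw, hwe⟩ := hC {a | a ∈ y₁} r u v hu₁ hv₁
      rw [evalFrom_eq_self fun a ha => hM.step_eq_self hfix.1 (hw a ha),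
        evalFrom_eq_self fun a ha => hM.step_eq_self hfix.2 (hw a ha)] at hwe
      rw [hwe]
    · rw [evalFrom_append, evalFrom_append, ← evalFrom_append r u, ← evalFrom_append r v]
      refine ih (Γ := {a | a ∈ y₁}) ?_ ?_ ?_ hy₂
      · simpa [or_imp, forall_and] using hu₁
      · simpa [or_imp, forall_and] using hv₁
      · rw [evalFrom_append, evalFrom_append]
        rcases not_and_or.1 hfix with h | h
        · have := hM.rank_lt (reaches_evalFrom _ y₁) h
          omega
        · have := hM.rank_lt (reaches_evalFrom _ y₁) h
          omega

theorem IsConfluent.prependDepth_lt (hM : IsPartiallyOrdered M) (hC : IsConfluent M) {p : σ}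
    {y : List α} {a : α} (h : M.evalFrom p (a :: y) ≠ M.evalFrom p y) :
    prependDepth y a < 2 * Fintype.card σ := by
  by_contra! hk
  have h₁ := rank_le_card (M := M) p
  have h₂ := rank_le_card (M := M) (M.evalFrom p [a])
  exact h (hC.evalFrom_eq hM (r := p) (Γ := {a}) (u := [a]) (v := []) (N := 2 * Fintype.card σ)
    (by simp) (by simp) (by simp only [DFA.evalFrom_nil]; omega) (by simpa using hk))

/-- The language of a partially ordered confluent automaton with `n` states is `3 n`-piecewise
testable, stated for the state reached. -/
theorem IsConfluent.eval_eq_of_subEquiv (hM : IsPartiallyOrdered M) (hC : IsConfluent M)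
    {u v : List α} (h : SubEquiv (3 * Fintype.card σ) u v) : M.eval u = M.eval v := by
  refine eq_of_subEquiv M.eval (fun x y a hk => ?_) h
  by_contra hne
  unfold DFA.eval at hne
  rw [evalFrom_append, evalFrom_append] at hne
  have h₁ := hC.prependDepth_lt hM hne
  have h₂ := hM.appendDepth_add_rank_le M.start (x := x) (a := a) fun he => hne <| by
    rw [DFA.evalFrom_append_singleton] at he
    rw [DFA.evalFrom_cons, he]
  have := rank_pos (M := M) (M.evalFrom M.start x)
  omega

/-! ### Short witnesses -/

variable [Fintype α]

/-- A word can be thinned out, keeping its set of letters and its action on two states, to a word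
that has one letter for each letter of the alphabet and for each change of a state. -/
theorem IsPartiallyOrdered.exists_short (hM : IsPartiallyOrdered M) (p q : σ) (w : List α) :
    ∃ w' : List α, (∀ a, a ∈ w' ↔ a ∈ w) ∧ M.evalFrom p w' = M.evalFrom p w ∧
      M.evalFrom q w' = M.evalFrom q w ∧
      w'.length ≤ 2 * Fintype.card σ + Fintype.card α := by
  suffices H : ∃ w' : List α, (∀ a, a ∈ w' ↔ a ∈ w) ∧ M.evalFrom p w' = M.evalFrom p w ∧
      M.evalFrom q w' = M.evalFrom q w ∧ w'.length ≤ rank M p + rank M q + w.toFinset.card by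
    obtain ⟨w', h₁, h₂, h₃, h₄⟩ := H
    have := rank_le_card (M := M) p
    have := rank_le_card (M := M) q
    have := w.toFinset.card_le_univ
    exact ⟨w', h₁, h₂, h₃, by omega⟩
  induction w generalizing p q with
  | nil => exact ⟨[], by simp⟩
  | cons b w ih =>
    obtain ⟨w', h₁, h₂, h₃, h₄⟩ := ih (M.step p b) (M.step q b)
    have hsub : w.toFinset.card ≤ (b :: w).toFinset.card :=
      Finset.card_le_card fun x => by simp +contextual
    have hp := rank_le_of_reaches (reaches_step (M := M) p b)
    have hq := rank_le_of_reaches (reaches_step (M := M) q b)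
    have hcons : ∀ a, a ∈ b :: w' ↔ a ∈ b :: w := fun a => by simp [h₁]
    by_cases hfix : M.step p b = p ∧ M.step q b = q
    · by_cases hb : b ∈ w
      · refine ⟨w', fun a => ?_, ?_, ?_, ?_⟩
        · rw [h₁, List.mem_cons]
          exact ⟨Or.inr, fun h => h.elim (fun h => h ▸ hb) id⟩
        · rw [DFA.evalFrom_cons, ← h₂, hfix.1]
        · rw [DFA.evalFrom_cons, ← h₃, hfix.2]
        · omega
      · refine ⟨b :: w', hcons, h₂, h₃, ?_⟩
        have : (b :: w).toFinset.card = w.toFinset.card + 1 := by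
          rw [List.toFinset_cons, Finset.card_insert_of_notMem (by simpa using hb)]
        simp only [List.length_cons]
        omega
    · refine ⟨b :: w', hcons, h₂, h₃, ?_⟩
      simp only [List.length_cons]
      rcases not_and_or.1 hfix with h | h
      · have := hM.rank_lt (reaches_step p b) h
        omega
      · have := hM.rank_lt (reaches_step q b) h
        omega

/-- A right context can be replaced by a short one, with the same action on two states, that absorbs
the letters of `Γ` equally well. -/
theorem IsPartiallyOrdered.exists_short_right (hM : IsPartiallyOrdered M) {r : ℕ} {Γ : Set α}
    (p q : σ) {y : List α} (h : ∀ c ∈ Γ, r ≤ prependDepth y c) :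
    ∃ y' : List α, (∀ c ∈ Γ, r ≤ prependDepth y' c) ∧ M.evalFrom p y' = M.evalFrom p y ∧
      M.evalFrom q y' = M.evalFrom q y ∧
      y'.length ≤ (r + 1) * (2 * Fintype.card σ + Fintype.card α) := by
  induction r generalizing p q y Γ with
  | zero =>
    obtain ⟨w, -, h₂, h₃, h₄⟩ := hM.exists_short p q y
    exact ⟨w, by simp, h₂, h₃, by simpa using h₄⟩
  | succ r ih =>
    obtain ⟨y₁, y₂, rfl, h₁, h₂⟩ := exists_arch h
    obtain ⟨w₁, hm, hp₁, hq₁, hl₁⟩ := hM.exists_short p q y₁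
    obtain ⟨w₂, hd, hp₂, hq₂, hl₂⟩ :=
      ih (Γ := {a | a ∈ y₁}) (M.evalFrom p y₁) (M.evalFrom q y₁) h₂
    refine ⟨w₁ ++ w₂, fun c hc => ?_, ?_, ?_, ?_⟩
    · exact lt_prependDepth_append (fun c hc => hd c ((hm c).1 hc)) ((hm c).2 (h₁ c hc))
    · rw [evalFrom_append, evalFrom_append, hp₁, hp₂]
    · rw [evalFrom_append, evalFrom_append, hq₁, hq₂]
    · rw [List.length_append, add_one_mul]
      omega

/-- A left context can be replaced by a short one, reaching the same state, that absorbs the letters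
of `Γ` equally well. -/
theorem IsPartiallyOrdered.exists_short_left (hM : IsPartiallyOrdered M) {r : ℕ} {Γ : Set α}
    (p : σ) {x : List α} (h : ∀ c ∈ Γ, r ≤ appendDepth x c) :
    ∃ x' : List α, (∀ c ∈ Γ, r ≤ appendDepth x' c) ∧ M.evalFrom p x' = M.evalFrom p x ∧
      x'.length ≤ (r + 1) * (2 * Fintype.card σ + Fintype.card α) := by
  induction r generalizing x Γ with
  | zero =>
    obtain ⟨w, -, h₂, -, h₄⟩ := hM.exists_short p p x
    exact ⟨w, by simp, h₂, by simpa using h₄⟩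
  | succ r ih =>
    obtain ⟨y₁, y₂, hy, h₁, h₂⟩ := exists_arch (y := x.reverse) h
    obtain rfl : x = y₂.reverse ++ y₁.reverse := by
      rw [← List.reverse_append, ← hy, List.reverse_reverse]
    obtain ⟨w₂, hd, hp₂, hl₂⟩ := ih (Γ := {a | a ∈ y₁}) (x := y₂.reverse) (by
      simpa [appendDepth] using h₂)
    obtain ⟨w₁, hm, hp₁, -, hl₁⟩ :=
      hM.exists_short (M.evalFrom p y₂.reverse) (M.evalFrom p y₂.reverse) y₁.reverse
    refine ⟨w₂ ++ w₁, fun c hc => ?_, ?_, ?_⟩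
    · rw [appendDepth, List.reverse_append]
      refine lt_prependDepth_append (fun c hc => hd c ?_) ?_
      · simpa [hm] using hc
      · simpa [hm] using h₁ c hc
    · rw [evalFrom_append, evalFrom_append, hp₂, hp₁]
    · rw [List.length_append, add_one_mul]
      omega

/-- To see whether `~_k`-equivalent words reach the same state of a partially ordered confluent
automaton, it suffices to look at words of polynomial length: a letter insertion that changes the
state reached has small depths on both sides, and both contexts can be thinned out without lowering
these depths. -/
theorem IsConfluent.eval_eq_of_short (hM : IsPartiallyOrdered M) (hC : IsConfluent M) {k B : ℕ}
    (hB : (3 * Fintype.card σ + 2) * (2 * Fintype.card σ + Fintype.card α) + 1 ≤ B)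
    (h : ∀ u v : List α, u.length ≤ B → v.length ≤ B → SubEquiv k u v → M.eval u = M.eval v)
    {u v : List α} (huv : SubEquiv k u v) : M.eval u = M.eval v := by
  refine eq_of_subEquiv M.eval (fun x y a hk => ?_) huv
  by_contra hne
  unfold DFA.eval at hne
  rw [evalFrom_append, evalFrom_append] at hne
  have h₁ := hC.prependDepth_lt hM hne
  have h₂ := hM.appendDepth_add_rank_le M.start (x := x) (a := a) fun he => hne <| by
    rw [DFA.evalFrom_append_singleton] at he
    rw [DFA.evalFrom_cons, he]
  obtain ⟨x', hx', hpx, hlx⟩ := hM.exists_short_left (r := appendDepth x a) (Γ := {a}) (x := x)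
    M.start (by simp)
  obtain ⟨y', hy', hpy, hqy, hly⟩ := hM.exists_short_right (r := prependDepth y a) (Γ := {a})
    (y := y) (M.evalFrom M.start x) (M.step (M.evalFrom M.start x) a) (by simp)
  have hlen : x'.length + y'.length + 1 ≤ B := by
    have h₃ : (appendDepth x a + 1) + (prependDepth y a + 1) ≤ 3 * Fintype.card σ + 2 := by omega
    have := Nat.mul_le_mul_right (2 * Fintype.card σ + Fintype.card α) h₃
    rw [add_mul] at this
    omega
  have := h (x' ++ a :: y') (x' ++ y') (by simp; omega) (by simp; omega)
    (subEquiv_insert_iff.2 (hk.trans (add_le_add (hx' a rfl) (hy' a rfl))))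
  unfold DFA.eval at this
  rw [evalFrom_append, evalFrom_append, hpx, DFA.evalFrom_cons, hpy, hqy] at this
  exact hne this

end Automata

/-! ### Register programs -/

/-- Structured programs over registers that hold natural numbers: increment, truncated decrement,
composition, and repetition as long as a register is nonzero. -/
inductive Prog (ρ : Type) : Type
  | inc (r : ρ) : Prog ρ
  | dec (r : ρ) : Prog ρ
  | seq (p q : Prog ρ) : Prog ρ
  | loop (r : ρ) (p : Prog ρ) : Prog ρ

namespace Prog

/-- Renaming of registers. -/
def map {ρ ρ' : Type} (f : ρ → ρ') : Prog ρ → Prog ρ'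
  | inc r => inc (f r)
  | dec r => dec (f r)
  | seq p q => seq (p.map f) (q.map f)
  | loop r p => loop (f r) (p.map f)

/-- All registers that occur in the program satisfy `P`. -/
def All {ρ : Type} (P : ρ → Prop) : Prog ρ → Prop
  | inc r => P r
  | dec r => P r
  | seq p q => p.All P ∧ q.All P
  | loop r p => P r ∧ p.All P

theorem All.imp {ρ : Type} {P Q : ρ → Prop} (h : ∀ r, P r → Q r) {p : Prog ρ} (hp : p.All P) :
    p.All Q := by
  induction p with
  | inc r => exact h r hp
  | dec r => exact h r hp
  | seq p q ihp ihq => exact ⟨ihp hp.1, ihq hp.2⟩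
  | loop r p ih => exact ⟨h r hp.1, ih hp.2⟩

theorem all_true {ρ : Type} (p : Prog ρ) : p.All fun _ => True := by
  induction p with
  | inc r => trivial
  | dec r => trivial
  | seq p q ihp ihq => exact ⟨ihp, ihq⟩
  | loop r p ih => exact ⟨trivial, ih⟩

theorem exists_all_lt (p : Prog ℕ) : ∃ R, p.All (· < R) := by
  induction p with
  | inc r => exact ⟨r + 1, Nat.lt_succ_self r⟩
  | dec r => exact ⟨r + 1, Nat.lt_succ_self r⟩
  | seq p q ihp ihq =>
    obtain ⟨R, hR⟩ := ihp
    obtain ⟨R', hR'⟩ := ihq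
    exact ⟨max R R', hR.imp fun r h => h.trans_le (le_max_left _ _),
      hR'.imp fun r h => h.trans_le (le_max_right _ _)⟩
  | loop r p ih =>
    obtain ⟨R, hR⟩ := ih
    exact ⟨max R (r + 1), lt_of_lt_of_le (Nat.lt_succ_self r) (le_max_right _ _),
      hR.imp fun r h => h.trans_le (le_max_left _ _)⟩

end Prog

open Function (update)

section Runs

variable {ρ : Type} [DecidableEq ρ]

/-- `Runs p s s' t`: started with register contents `s`, the program `p` ends with register contents
`s'` after exactly `t` steps. -/
inductive Runs : Prog ρ → (ρ → ℕ) → (ρ → ℕ) → ℕ → Prop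
  | inc (r : ρ) (s : ρ → ℕ) : Runs (.inc r) s (update s r (s r + 1)) 1
  | dec (r : ρ) (s : ρ → ℕ) : Runs (.dec r) s (update s r (s r - 1)) 1
  | seq {p q : Prog ρ} {s s' s'' : ρ → ℕ} {t t' : ℕ} :
      Runs p s s' t → Runs q s' s'' t' → Runs (.seq p q) s s'' (t + t')
  | loop_zero {r : ρ} {p : Prog ρ} {s : ρ → ℕ} : s r = 0 → Runs (.loop r p) s s 1
  | loop_succ {r : ρ} {p : Prog ρ} {s s' s'' : ρ → ℕ} {t t' : ℕ} :
      s r ≠ 0 → Runs p s s' t → Runs (.loop r p) s' s'' t' → Runs (.loop r p) s s'' (1 + t + t')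

/-- A run is not affected by an injective renaming of the registers. -/
theorem Runs.map {ρ' : Type} [DecidableEq ρ'] {f : ρ → ρ'} {P : ρ → Prop}
    (hf : ∀ r r', P r → P r' → f r = f r' → r = r') {p : Prog ρ} {s s' : ρ → ℕ} {t : ℕ}
    (h : Runs p s s' t) (hp : p.All P) {S : ρ' → ℕ} (hS : ∀ r, P r → S (f r) = s r) :
    ∃ S', Runs (p.map f) S S' t ∧ (∀ r, P r → S' (f r) = s' r) ∧
      ∀ x, (∀ r, P r → f r ≠ x) → S' x = S x := by
  have upd : ∀ (r₀ : ρ) (s : ρ → ℕ) (S : ρ' → ℕ) (v : ℕ), P r₀ → (∀ r, P r → S (f r) = s r) →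
      (∀ r, P r → update S (f r₀) v (f r) = update s r₀ v r) ∧
      ∀ x, (∀ r, P r → f r ≠ x) → update S (f r₀) v x = S x := by
    intro r₀ s S v h₀ hS
    refine ⟨fun r hr => ?_, fun x hx => Function.update_of_ne (fun h => hx r₀ h₀ h.symm) _ _⟩
    by_cases hrr : r = r₀
    · subst hrr; simp
    · rw [Function.update_of_ne hrr, Function.update_of_ne (fun h => hrr (hf r r₀ hr h₀ h)),
        hS r hr]
  induction h generalizing S with
  | inc r s =>
    refine ⟨_, Runs.inc (f r) S, ?_⟩
    rw [hS r hp]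
    exact upd r s S _ hp hS
  | dec r s =>
    refine ⟨_, Runs.dec (f r) S, ?_⟩
    rw [hS r hp]
    exact upd r s S _ hp hS
  | seq _ _ ih ih' =>
    obtain ⟨S₁, h₁, h₂, h₃⟩ := ih hp.1 hS
    obtain ⟨S₂, h₁', h₂', h₃'⟩ := ih' hp.2 h₂
    exact ⟨S₂, h₁.seq h₁', h₂', fun x hx => (h₃' x hx).trans (h₃ x hx)⟩
  | loop_zero h0 => exact ⟨S, .loop_zero ((hS _ hp.1).trans h0), hS, fun _ _ => rfl⟩
  | loop_succ h0 _ _ ih ih' =>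
    obtain ⟨S₁, h₁, h₂, h₃⟩ := ih hp.2 hS
    obtain ⟨S₂, h₁', h₂', h₃'⟩ := ih' hp h₂
    exact ⟨S₂, .loop_succ (by rwa [hS _ hp.1]) h₁ h₁', h₂', fun x hx => (h₃' x hx).trans (h₃ x hx)⟩

/-- A loop whose body, run in the round `i`, turns `S i` into `S (i + 1)`. -/
theorem Runs.loop_iterate {r : ρ} {p : Prog ρ} (n : ℕ) (S : ℕ → ρ → ℕ) (τ : ℕ → ℕ)
    (hr : ∀ i < n, S i r ≠ 0) (hn : S n r = 0) (hp : ∀ i < n, Runs p (S i) (S (i + 1)) (τ i)) :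
    Runs (.loop r p) (S 0) (S n) ((∑ i ∈ Finset.range n, (1 + τ i)) + 1) := by
  induction n generalizing S τ with
  | zero => simpa using Runs.loop_zero hn
  | succ n ih =>
    have := ih (fun i => S (i + 1)) (fun i => τ (i + 1)) (fun i hi => hr (i + 1) (by omega)) hn
      fun i hi => hp (i + 1) (by omega)
    rw [Finset.sum_range_succ']
    convert Runs.loop_succ (hr 0 (by omega)) (hp 0 (by omega)) this using 1
    ring

/-- Replaces the data of a run by equal ones. -/
theorem Runs.cast {p : Prog ρ} {s s' s₁ s₁' : ρ → ℕ} {t t₁ : ℕ} (h : Runs p s s' t)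
    (hs : s₁ = s) (hs' : s₁' = s') (ht : t₁ = t) : Runs p s₁ s₁' t₁ :=
  hs ▸ hs' ▸ ht ▸ h

/-- Sets the register `r` to zero. -/
def Prog.clear (r : ρ) : Prog ρ := .loop r (.dec r)

theorem runs_clear (r : ρ) (s : ρ → ℕ) : Runs (.clear r) s (update s r 0) (2 * s r + 1) := by
  refine (Runs.loop_iterate (r := r) (p := .dec r) (s r) (fun i => update s r (s r - i))
    (fun _ => 1) (fun i hi => by simp; omega) (by simp) (fun i _ => ?_)).cast (by simp) (by simp)
    (by simp [mul_comm])
  refine (Runs.dec r (update s r (s r - i))).cast rfl ?_ rfl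
  simp [Nat.sub_sub]

/-- Adds the register `r` to the register `d` and sets `r` to zero. -/
def Prog.move (r d : ρ) : Prog ρ := .loop r (.seq (.dec r) (.inc d))

theorem runs_move {r d : ρ} (hrd : r ≠ d) (s : ρ → ℕ) :
    Runs (.move r d) s (update (update s d (s d + s r)) r 0) (3 * s r + 1) := by
  refine (Runs.loop_iterate (r := r) (p := .seq (.dec r) (.inc d)) (s r)
    (fun i => update (update s d (s d + i)) r (s r - i)) (fun _ => 1 + 1)
    (fun i hi => by simp; omega) (by simp) (fun i _ => ?_)).cast (by simp) (by simp)
    (by simp [mul_comm])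
  refine ((Runs.dec r _).seq (Runs.inc d _)).cast rfl ?_ rfl
  ext x
  by_cases hx : x = r
  · subst hx; simp [hrd, Nat.sub_sub]
  · by_cases hx' : x = d
    · subst hx'; simp [hx, add_assoc]
    · simp [hx, hx']

/-- Adds the register `r` to the register `d`, using an auxiliary register `a` that holds zero. -/
def Prog.copy (r d a : ρ) : Prog ρ :=
  .seq (.loop r (.seq (.dec r) (.seq (.inc d) (.inc a)))) (.move a r)

theorem runs_copy {r d a : ρ} (hrd : r ≠ d) (hra : r ≠ a) (hda : d ≠ a) (s : ρ → ℕ)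
    (ha : s a = 0) : Runs (.copy r d a) s (update s d (s d + s r)) (7 * s r + 2) := by
  have h₁ := Runs.loop_iterate (r := r) (p := .seq (.dec r) (.seq (.inc d) (.inc a))) (s r)
    (fun i => update (update (update s d (s d + i)) a i) r (s r - i)) (fun _ => 1 + (1 + 1))
    (fun i hi => by simp; omega) (by simp) (fun i _ => by
      refine ((Runs.dec r _).seq ((Runs.inc d _).seq (Runs.inc a _))).cast rfl ?_ rfl
      ext x
      by_cases hx : x = r
      · subst hx; simp [hrd, hra, Nat.sub_sub]
      · by_cases hx' : x = d
        · subst hx'; simp [hx, hda, add_assoc]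
        · by_cases hx'' : x = a
          · subst hx''; simp [hx, hx']
          · simp [hx, hx', hx''])
  refine (h₁.seq (runs_move (Ne.symm hra) _)).cast ?_ ?_ ?_
  · ext x
    by_cases hx : x = r
    · subst hx; simp
    · by_cases hx' : x = a
      · subst hx'; simp [hx, ha]
      · simp [hx, hx']
  · ext x
    by_cases hx : x = a
    · subst hx; simp [Ne.symm hda, ha]
    · by_cases hx' : x = r
      · subst hx'; simp [hrd, hra, Ne.symm hra]
      · simp [hx, hx']
  · simp [Ne.symm hra]; ring

end Runs

/-! ### Functions computable in quasi-polynomial time -/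

/-- The register contents with the values in `l` in the first registers and zeros behind. -/
def store (l : List ℕ) : ℕ → ℕ := fun i => l.getD i 0

theorem store_append_zero (l : List ℕ) : store (l ++ [0]) = store l := by
  ext i
  rcases lt_trichotomy i l.length with h | rfl | h
  · simp [store, List.getElem?_append_left h]
  · simp [store]
  · simp [store, List.getElem?_eq_none h.le, List.getElem?_append_right h.le,
      show i - l.length ≠ 0 by omega]

theorem update_store {l : List ℕ} {i : ℕ} (h : i < l.length) (v : ℕ) :
    update (store l) i v = store (l.set i v) := by
  ext j
  by_cases hij : j = i
  · subst hij; simp [store, h]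
  · simp [store, hij, List.getElem?_set_ne (Ne.symm hij)]

theorem store_of_length_le {l : List ℕ} {i : ℕ} (h : l.length ≤ i) : store l i = 0 := by
  simp [store, List.getElem?_eq_none h]

theorem update_store_length (l : List ℕ) (v : ℕ) :
    update (store l) l.length v = store (l ++ [v]) := by
  rw [← store_append_zero, update_store (by simp)]
  simp

/-- A program that computes on `l₁ ++ l₂` can be made to leave a gap for the values `c`. -/
theorem Runs.skip {p : Prog ℕ} {l₁ l₂ : List ℕ} {v t : ℕ}
    (h : Runs p (store (l₁ ++ l₂)) (store (l₁ ++ l₂ ++ [v])) t) (c : List ℕ) :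
    Runs (p.map fun i => if i < l₁.length then i else i + c.length)
      (store (l₁ ++ c ++ l₂)) (store (l₁ ++ c ++ l₂ ++ [v])) t := by
  have key : ∀ (l : List ℕ) (r : ℕ), store (l₁ ++ c ++ l)
      (if r < l₁.length then r else r + c.length) = store (l₁ ++ l) r := by
    intro l r
    split_ifs with hr
    · simp [store, List.append_assoc, List.getElem?_append_left hr]
    · simp only [store, List.getD_eq_getElem?_getD]
      rw [List.getElem?_append_right (by simp; omega), List.getElem?_append_right (by omega)]
      simp only [List.length_append]
      congr 2
      omega
  obtain ⟨S', h₁, h₂, h₃⟩ := h.map (P := fun _ => True)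
    (f := fun i => if i < l₁.length then i else i + c.length)
    (fun r r' _ _ hrr => by split_ifs at hrr <;> omega)
    p.all_true (fun r _ => key l₂ r)
  suffices hS : S' = store (l₁ ++ c ++ l₂ ++ [v]) from hS ▸ h₁
  ext x
  by_cases hx : ∃ r, (if r < l₁.length then r else r + c.length) = x
  · obtain ⟨r, rfl⟩ := hx
    rw [h₂ r trivial, List.append_assoc _ l₂, List.append_assoc _ l₂, key]
  · push Not at hx
    rw [h₃ x fun r _ => hx r]
    have hx₁ : l₁.length ≤ x := by
      by_contra! hlt
      exact hx x (if_pos hlt)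
    have hx₂ : x < l₁.length + c.length := by
      by_contra! hle
      exact hx (x - c.length) (by rw [if_neg (by omega)]; omega)
    simp only [store, List.getD_eq_getElem?_getD]
    rw [List.append_assoc (l₁ ++ c), List.getElem?_append_left (l₁ := l₁ ++ c) (by simpa),
      List.getElem?_append_left (l₁ := l₁ ++ c) (by simpa)]

section Closure

variable {E : Type}

/-- `T` is quasi-polynomially bounded in the functions `args`: for some constant `c` it is at most
`2 ^ ℓ ^ c` wherever all of `args` are at most `2 ^ ℓ`. -/
def QuasiPoly (args : List (E → ℕ)) (T : E → ℕ) : Prop :=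
  ∃ c, ∀ ℓ ≥ 2, ∀ e, (∀ a ∈ args, a e ≤ 2 ^ ℓ) → T e ≤ 2 ^ ℓ ^ c

theorem pow_max_left {ℓ : ℕ} (hℓ : 2 ≤ ℓ) (c d : ℕ) : ℓ ^ c ≤ ℓ ^ max c d :=
  Nat.pow_le_pow_right (by omega) (le_max_left c d)

theorem pow_max_right {ℓ : ℕ} (hℓ : 2 ≤ ℓ) (c d : ℕ) : ℓ ^ d ≤ ℓ ^ max c d :=
  Nat.pow_le_pow_right (by omega) (le_max_right c d)

namespace QuasiPoly

variable {args : List (E → ℕ)} {T T' : E → ℕ}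

theorem of_le (h : QuasiPoly args T') (hle : ∀ e, T e ≤ T' e) : QuasiPoly args T := by
  obtain ⟨c, hc⟩ := h
  exact ⟨c, fun ℓ hℓ e he => (hle e).trans (hc ℓ hℓ e he)⟩

/-- The exponents add up to at most `2 * ℓ ^ max c d ≤ ℓ ^ (max c d + 1)`. -/
theorem mul (h : QuasiPoly args T) (h' : QuasiPoly args T') :
    QuasiPoly args fun e => T e * T' e := by
  obtain ⟨c, hc⟩ := h
  obtain ⟨d, hd⟩ := h'
  refine ⟨max c d + 1, fun ℓ hℓ e he => (Nat.mul_le_mul (hc ℓ hℓ e he) (hd ℓ hℓ e he)).trans ?_⟩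
  rw [← pow_add, pow_succ]
  refine Nat.pow_le_pow_right (by omega) ?_
  have h₁ := pow_max_left hℓ c d
  have h₂ := pow_max_right hℓ c d
  have h₃ := Nat.mul_le_mul_left (ℓ ^ max c d) hℓ
  omega

theorem const (k : ℕ) : QuasiPoly args fun _ => k := by
  refine ⟨k, fun ℓ hℓ e _ => ?_⟩
  have h₁ : k < 2 ^ k := Nat.lt_two_pow_self
  have h₂ : 2 ^ k ≤ ℓ ^ k := Nat.pow_le_pow_left hℓ k
  have h₃ : ℓ ^ k < 2 ^ ℓ ^ k := Nat.lt_two_pow_self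
  exact (h₁.trans_le h₂).le.trans h₃.le

theorem add (h : QuasiPoly args T) (h' : QuasiPoly args T') :
    QuasiPoly args fun e => T e + T' e := by
  have : QuasiPoly args fun e => 2 * (max (T e) 1 * max (T' e) 1) := by
    have aux : ∀ {T : E → ℕ}, QuasiPoly args T → QuasiPoly args fun e => max (T e) 1 := by
      rintro T ⟨c, hc⟩
      exact ⟨c, fun ℓ hℓ e he => max_le (hc ℓ hℓ e he) Nat.one_le_two_pow⟩
    exact (const 2).mul ((aux h).mul (aux h'))
  refine this.of_le fun e => ?_
  have h₁ := Nat.mul_le_mul (le_max_left (T e) 1) (le_max_right (T' e) 1)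
  have h₂ := Nat.mul_le_mul (le_max_right (T e) 1) (le_max_left (T' e) 1)
  omega

theorem arg {a : E → ℕ} (ha : a ∈ args) : QuasiPoly args a :=
  ⟨1, fun ℓ _ e he => by simpa using he a ha⟩

/-- Substitution of quasi-polynomially bounded functions. -/
theorem comp {E' : Type} {args' : List (E' → ℕ)} {φ : E' → E} (h : QuasiPoly args T)
    (hφ : ∀ a ∈ args, QuasiPoly args' fun e => a (φ e)) : QuasiPoly args' fun e => T (φ e) := by
  have key : ∀ as : List (E → ℕ), (∀ a ∈ as, QuasiPoly args' fun e => a (φ e)) →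
      ∃ c, ∀ a ∈ as, ∀ ℓ ≥ 2, ∀ e, (∀ a' ∈ args', a' e ≤ 2 ^ ℓ) → a (φ e) ≤ 2 ^ ℓ ^ c := by
    intro as has
    induction as with
    | nil => exact ⟨0, by simp⟩
    | cons b as ih =>
      obtain ⟨c, hc⟩ := ih fun a ha => has a (List.mem_cons_of_mem b ha)
      obtain ⟨d, hd⟩ := has b List.mem_cons_self
      refine ⟨max c d, fun a ha ℓ hℓ e he => ?_⟩
      rcases List.mem_cons.1 ha with rfl | ha
      · exact (hd ℓ hℓ e he).trans (Nat.pow_le_pow_right (by omega) (pow_max_right hℓ c d))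
      · exact (hc a ha ℓ hℓ e he).trans (Nat.pow_le_pow_right (by omega) (pow_max_left hℓ c d))
  obtain ⟨c, hc⟩ := key args hφ
  obtain ⟨d, hd⟩ := h
  refine ⟨max c 1 * d, fun ℓ hℓ e he => ?_⟩
  rw [pow_mul]
  have h₁ := pow_max_left hℓ c 1
  have h₂ : ℓ ≤ ℓ ^ max c 1 := by simpa using pow_max_right hℓ c 1
  exact hd _ (hℓ.trans h₂) (φ e) fun a ha =>
    (hc a ha ℓ hℓ e he).trans (Nat.pow_le_pow_right (by omega) h₁)

theorem mono {args' : List (E → ℕ)} (hsub : ∀ a ∈ args, a ∈ args') (h : QuasiPoly args T) :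
    QuasiPoly args' T :=
  h.comp (φ := id) fun a ha => arg (hsub a ha)

theorem comap {E' : Type} (φ : E' → E) (h : QuasiPoly args T) :
    QuasiPoly (args.map (· ∘ φ)) fun e => T (φ e) :=
  h.comp fun _ ha => arg (List.mem_map_of_mem (f := (· ∘ φ)) ha)

/-- The summands need to be bounded only where they occur, hence the subtype. -/
theorem sum {n : E → ℕ} {τ : E → ℕ → ℕ} (hn : QuasiPoly args n)
    (h : QuasiPoly (args.map fun f => fun x : {x : E × ℕ // x.2 < n x.1} => f x.1.1)
      fun x => τ x.1.1 x.1.2) :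
    QuasiPoly args fun e => ∑ i ∈ Finset.range (n e), τ e i := by
  obtain ⟨c, hc⟩ := h
  have hM : QuasiPoly args fun e => (Finset.range (n e)).sup (τ e) := by
    refine ⟨c, fun ℓ hℓ e he => Finset.sup_le fun i hi => ?_⟩
    exact hc ℓ hℓ ⟨(e, i), Finset.mem_range.1 hi⟩ (by simpa using he)
  refine (hn.mul hM).of_le fun e => ?_
  have := Finset.sum_le_card_nsmul (Finset.range (n e)) (τ e) _ fun i hi => Finset.le_sup hi
  simpa using this

end QuasiPoly

/-- The values of the functions `args` at `e`. -/
def vals (args : List (E → ℕ)) (e : E) : List ℕ := args.map (· e)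

@[simp] theorem length_vals (args : List (E → ℕ)) (e : E) : (vals args e).length = args.length := by
  simp [vals]

theorem vals_append (as bs : List (E → ℕ)) (e : E) :
    vals (as ++ bs) e = vals as e ++ vals bs e := by
  simp [vals]

/-- The function `f : E → ℕ` can be computed from the functions `args`, in time quasi-polynomial in
their values: some program that finds the values of `args` at a point `e` in its first registers,
and zeros behind, puts the value of `f` at `e` into the next register and changes nothing else. -/
def QPComputable (args : List (E → ℕ)) (f : E → ℕ) : Prop :=
  ∃ (p : Prog ℕ) (T : E → ℕ), QuasiPoly args T ∧ QuasiPoly args f ∧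
    ∀ e, Runs p (store (vals args e)) (store (vals args e ++ [f e])) (T e)

namespace QPComputable

variable {args : List (E → ℕ)} {f g h : E → ℕ}

theorem quasiPoly (hf : QPComputable args f) : QuasiPoly args f :=
  let ⟨_, _, _, h, _⟩ := hf; h

theorem var (hf : f ∈ args) : QPComputable args f := by
  obtain ⟨i, hi, hif⟩ := List.getElem_of_mem hf
  refine ⟨.copy i args.length (args.length + 1), fun e => 7 * f e + 2,
    ((QuasiPoly.const 7).mul (.arg hf)).add (.const 2), .arg hf, fun e => ?_⟩
  have hv : store (vals args e) i = f e := by simp [store, vals, hi, hif]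
  refine (runs_copy (r := i) (d := args.length) (a := args.length + 1) (by omega) (by omega)
    (by omega) (store (vals args e)) (store_of_length_le (by simp))).cast rfl ?_ ?_
  · rw [store_of_length_le (i := args.length) (by simp), zero_add, hv,
      ← update_store_length, length_vals]
  · rw [hv]

theorem zero : QPComputable args fun _ => 0 := by
  refine ⟨.seq (.inc 0) (.dec 0), fun _ => 1 + 1, .const 2, .const 0, fun e => ?_⟩
  refine ((Runs.inc 0 _).seq (Runs.dec 0 _)).cast rfl ?_ rfl
  simp [store_append_zero]

theorem succ (hf : QPComputable args f) : QPComputable args fun e => f e + 1 := by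
  obtain ⟨p, T, hT, hf, hp⟩ := hf
  refine ⟨.seq p (.inc args.length), fun e => T e + 1, hT.add (.const 1), hf.add (.const 1),
    fun e => ?_⟩
  refine ((hp e).seq (Runs.inc args.length _)).cast rfl ?_ rfl
  rw [update_store (by simp)]
  simp [store]

theorem const (k : ℕ) : QPComputable args fun _ => k := by
  induction k with
  | zero => exact zero
  | succ k ih => exact ih.succ

theorem comap {E' : Type} (φ : E' → E) (hf : QPComputable args f) :
    QPComputable (args.map (· ∘ φ)) (fun e => f (φ e)) := by
  obtain ⟨p, T, hT, hf, hp⟩ := hf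
  refine ⟨p, fun e => T (φ e), hT.comap φ, hf.comap φ, fun e => ?_⟩
  have : vals (args.map (· ∘ φ)) e = vals args (φ e) := by simp [vals]
  rw [this]
  exact hp (φ e)

theorem weaken (hf : QPComputable args f) (bs : List (E → ℕ)) : QPComputable (args ++ bs) f := by
  obtain ⟨p, T, hT, hf, hp⟩ := hf
  have hsub : ∀ a ∈ args, a ∈ args ++ bs := fun a ha => List.mem_append_left bs ha
  refine ⟨p.map fun i => if i < args.length then i else i + bs.length, T, hT.mono hsub,
    hf.mono hsub, fun e => ?_⟩
  have := Runs.skip (l₁ := vals args e) (l₂ := []) (by simpa using hp e) (vals bs e)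
  simpa [vals_append] using this

/-- Computations under two additional variables, the loop index and the accumulator. -/
theorem lift₂ (hf : QPComputable args f) : QPComputable
    (args.map (· ∘ Prod.fst) ++ [fun x : E × ℕ × ℕ => x.2.1, fun x => x.2.2])
    (fun x => f x.1) :=
  (hf.comap Prod.fst).weaken _

end QPComputable

/-- Primitive recursion: `natFold x s n = s (n - 1) (⋯ (s 1 (s 0 x)))`. -/
def natFold (x : ℕ) (s : ℕ → ℕ → ℕ) : ℕ → ℕ
  | 0 => x
  | n + 1 => s n (natFold x s n)

/-- Bounded primitive recursion, provided that the intermediate values stay quasi-polynomially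
bounded. The program keeps the remaining number of rounds, the index of the round and the
accumulator in three consecutive registers. -/
theorem QPComputable.natFold {args : List (E → ℕ)} {n x : E → ℕ} {s : E × ℕ × ℕ → ℕ}
    (hn : QPComputable args n) (hx : QPComputable args x)
    (hs : QPComputable
      (args.map (· ∘ Prod.fst) ++ [fun x : E × ℕ × ℕ => x.2.1, fun x => x.2.2]) s)
    {b : E → ℕ} (hb : QuasiPoly args b)
    (hle : ∀ e, ∀ i ≤ n e, natFold (x e) (fun i a => s (e, i, a)) i ≤ b e) :
    QPComputable args fun e => natFold (x e) (fun i a => s (e, i, a)) (n e) := by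
  obtain ⟨p, T, hT, hn, hp⟩ := hn
  obtain ⟨q, T', hT', hx, hq⟩ := hx
  obtain ⟨r, T'', hT'', hs, hr⟩ := hs
  -- the accumulator after a number of rounds
  set R : E → ℕ → ℕ := fun e => PTAutomata.natFold (x e) (fun i a => s (e, i, a)) with hR
  set N := args.length with hN
  have hRn : QuasiPoly args fun e => R e (n e) := hb.of_le fun e => hle e _ le_rfl
  let body : Prog ℕ := .seq (.dec N) (.seq (r.map fun i => if i < N then i else i + 1)
    (.seq (.clear (N + 2)) (.seq (.move (N + 3) (N + 2)) (.inc (N + 1)))))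
  let τ : E → ℕ → ℕ := fun e i =>
    1 + (T'' (e, i, R e i) + ((2 * R e i + 1) + ((3 * R e (i + 1) + 1) + 1)))
  refine ⟨.seq p (.seq (q.map fun i => if i < N then i else i + 2)
    (.seq (.loop N body) (.seq (.clear (N + 1)) (.move (N + 2) N)))),
    fun e => T e + (T' e + (((∑ i ∈ Finset.range (n e), (1 + τ e i)) + 1) +
      ((2 * n e + 1) + (3 * R e (n e) + 1)))), ?_, hRn, fun e => ?_⟩
  · refine hT.add (hT'.add ((QuasiPoly.add (QuasiPoly.sum hn ?_) (.const 1)).add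
      ((((QuasiPoly.const 2).mul hn).add (.const 1)).add
        (((QuasiPoly.const 3).mul hRn).add (.const 1)))))
    have lift : ∀ {f : E → ℕ}, QuasiPoly args f →
        QuasiPoly (args.map fun a => fun x : {x : E × ℕ // x.2 < n x.1} => a x.1.1)
          fun x => f x.1.1 :=
      fun hf => hf.comap fun x : {x : E × ℕ // x.2 < n x.1} => x.1.1
    have h₁ : QuasiPoly (args.map fun a => fun x : {x : E × ℕ // x.2 < n x.1} => a x.1.1)
        fun x => x.1.2 := (lift hn).of_le fun x => x.2.le
    have h₂ : QuasiPoly (args.map fun a => fun x : {x : E × ℕ // x.2 < n x.1} => a x.1.1)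
        fun x => R x.1.1 x.1.2 := (lift hb).of_le fun x => hle _ _ x.2.le
    have h₃ : QuasiPoly (args.map fun a => fun x : {x : E × ℕ // x.2 < n x.1} => a x.1.1)
        fun x => R x.1.1 (x.1.2 + 1) := (lift hb).of_le fun x => hle _ _ x.2
    refine (QuasiPoly.const 1).add ((QuasiPoly.const 1).add (QuasiPoly.add ?_
      ((((QuasiPoly.const 2).mul h₂).add (.const 1)).add
        ((((QuasiPoly.const 3).mul h₃).add (.const 1)).add (.const 1)))))
    refine hT''.comp (φ := fun x : {x : E × ℕ // x.2 < n x.1} =>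
      (x.1.1, x.1.2, R x.1.1 x.1.2)) fun a ha => ?_
    simp only [List.mem_append, List.mem_map, List.mem_cons, List.not_mem_nil, or_false] at ha
    rcases ha with ⟨a, ha, rfl⟩ | rfl | rfl
    · exact lift (.arg ha)
    · exact h₁
    · exact h₂
  · have hv : (vals args e).length = N := length_vals args e
    have h₁ := hp e
    have h₂ := Runs.skip (l₁ := vals args e) (l₂ := []) (by simpa using hq e) [n e, 0]
    rw [hv] at h₂
    have h₃ := Runs.loop_iterate (r := N) (p := body) (n e)
      (fun i => store (vals args e ++ [n e - i, i, R e i])) (τ e)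
      (fun i hi => by simp [store, ← hv]; omega) (by simp [store, ← hv]) fun i hi => by
        have h₄ := hr (e, i, R e i)
        have hval : vals (args.map (· ∘ Prod.fst) ++
            [fun x : E × ℕ × ℕ => x.2.1, fun x => x.2.2]) (e, i, R e i) =
            vals args e ++ [i, R e i] := by simp [vals]
        rw [hval] at h₄
        have h₅ := h₄.skip [n e - (i + 1)]
        rw [hv] at h₅
        refine (Runs.dec N _).seq ((h₅.cast ?_ rfl rfl).seq
          ((runs_clear (N + 2) _).cast rfl rfl ?_ |>.seq
          ((runs_move (r := N + 3) (d := N + 2) (by omega) _).cast rfl rfl ?_ |>.seq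
          ((Runs.inc (N + 1) _).cast rfl ?_ rfl))))
        · rw [update_store (by simp [hv])]
          simp [store, ← hv, Nat.sub_sub]
        · simp [store, ← hv]
        · simp [store, ← hv, hR, PTAutomata.natFold]
        · have h₆ := store_append_zero (vals args e ++ [n e - (i + 1), i + 1, R e (i + 1)])
          rw [← h₆, update_store (by simp [hv]), update_store (by simp [hv]),
            update_store (by simp [hv]), update_store (by simp [hv])]
          simp [store, ← hv, hR, PTAutomata.natFold]
    refine h₁.seq ((h₂.cast ?_ rfl rfl).seq ((h₃.cast ?_ rfl rfl).seq
      ((runs_clear (N + 1) _).cast rfl rfl ?_ |>.seq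
      ((runs_move (r := N + 2) (d := N) (by omega) _).cast rfl ?_ ?_))))
    · rw [← store_append_zero]
      simp
    · simp [hR, PTAutomata.natFold]
    · simp [store, ← hv]
    · rw [← store_append_zero, ← store_append_zero, update_store (by simp [hv]),
        update_store (by simp [hv]), update_store (by simp [hv])]
      simp [store, ← hv]
      rfl
    · simp [store, ← hv, hR]

end Closure

/-! ### Compiling register programs to stack machines -/

section Compile

open Turing TM2

/-- The program points of a register program. -/
def Lab {ρ : Type} : Prog ρ → Type
  | .inc _ => Unit
  | .dec _ => Unit
  | .seq p q => Lab p ⊕ Lab q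
  | .loop _ p => Option (Lab p)

noncomputable instance fintypeLab {ρ : Type} : (p : Prog ρ) → Fintype (Lab p)
  | .inc _ => inferInstanceAs (Fintype Unit)
  | .dec _ => inferInstanceAs (Fintype Unit)
  | .seq p q => @instFintypeSum _ _ (fintypeLab p) (fintypeLab q)
  | .loop _ p => @instFintypeOption _ (fintypeLab p)

/-- The first program point. -/
def entry {ρ : Type} : (p : Prog ρ) → Lab p
  | .inc _ => ()
  | .dec _ => ()
  | .seq p _ => Sum.inl (entry p)
  | .loop _ _ => none

variable {ρ Λ : Type}

/-- The stack machine code of a register program, where `emb` places its program points among the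
labels of the machine and `exit` is the label to continue at. The stack `some r` holds the content
of the register `r` in unary; the stack `none` is reserved for the input. -/
def code : (p : Prog ρ) → (Lab p → Λ) → Λ → Lab p →
    TM2.Stmt (fun _ : Option ρ => Bool) Λ (Option Bool)
  | .inc r, _, exit, _ => .push (some r) (fun _ => true) (.goto fun _ => exit)
  | .dec r, _, exit, _ => .pop (some r) (fun v _ => v) (.goto fun _ => exit)
  | .seq p q, emb, _, .inl l => code p (emb ∘ Sum.inl) (emb (.inr (entry q))) l
  | .seq _ q, emb, exit, .inr l => code q (emb ∘ Sum.inr) exit l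
  | .loop r p, emb, exit, none =>
    .peek (some r) (fun _ x => x) (.branch Option.isSome
      (.load (fun _ => none) (.goto fun _ => emb (some (entry p)))) (.goto fun _ => exit))
  | .loop _ p, emb, _, some l => code p (emb ∘ some) (emb none) l

/-- The stacks that represent the rest `x` of the input and the register contents `s`. -/
def stackOf (x : List Bool) (s : ρ → ℕ) : Option ρ → List Bool
  | none => x
  | some r => List.replicate (s r) true

variable [DecidableEq ρ]

theorem update_stackOf (x : List Bool) (s : ρ → ℕ) (r : ρ) (n : ℕ) :
    Function.update (stackOf x s) (some r) (List.replicate n true) =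
      stackOf x (Function.update s r n) := by
  ext1 k
  cases k with
  | none => simp [stackOf]
  | some r' =>
    by_cases h : r' = r
    · subst h; simp [stackOf]
    · simp [stackOf, h]

/-- The machine `M` gets from `c` to `c'` in exactly `t` steps. -/
def StepsTo (M : Λ → TM2.Stmt (fun _ : Option ρ => Bool) Λ (Option Bool))
    (c c' : TM2.Cfg (fun _ : Option ρ => Bool) Λ (Option Bool)) (t : ℕ) : Prop :=
  (flip bind (TM2.step M))^[t] (some c) = some c'

variable {M : Λ → TM2.Stmt (fun _ : Option ρ => Bool) Λ (Option Bool)}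

theorem StepsTo.trans {c c' c'' : TM2.Cfg (fun _ : Option ρ => Bool) Λ (Option Bool)} {t t' : ℕ}
    (h : StepsTo M c c' t) (h' : StepsTo M c' c'' t') : StepsTo M c c'' (t + t') := by
  unfold StepsTo at *
  rw [add_comm, Function.iterate_add_apply, h, h']

theorem StepsTo.one {l : Λ} {v : Option Bool} {S : Option ρ → List Bool} :
    StepsTo M ⟨some l, v, S⟩ (TM2.stepAux (M l) v S) 1 :=
  rfl

/-- The code of a register program runs for exactly as many steps as the program. -/
theorem Runs.stepsTo {p : Prog ρ} {s s' : ρ → ℕ} {t : ℕ} (h : Runs p s s' t) {emb : Lab p → Λ}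
    {exit : Λ} (hM : ∀ l, M (emb l) = code p emb exit l) (x : List Bool) :
    StepsTo M ⟨some (emb (entry p)), none, stackOf x s⟩ ⟨some exit, none, stackOf x s'⟩ t := by
  induction h generalizing exit with
  | inc r s =>
    have h₁ := StepsTo.one (M := M) (l := emb (entry (.inc r))) (v := none) (S := stackOf x s)
    rw [hM] at h₁
    rw [← update_stackOf, List.replicate_succ]
    exact h₁
  | dec r s =>
    have h₁ := StepsTo.one (M := M) (l := emb (entry (.dec r))) (v := none) (S := stackOf x s)
    rw [hM] at h₁
    rw [← update_stackOf, ← List.tail_replicate]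
    exact h₁
  | @seq p q _ _ _ _ _ _ _ ih ih' =>
    exact (ih (emb := emb ∘ Sum.inl) fun l => hM (.inl l)).trans
      (ih' (emb := emb ∘ Sum.inr) fun l => hM (.inr l))
  | @loop_zero r p s h0 =>
    have h₁ := StepsTo.one (M := M) (l := emb none) (v := none) (S := stackOf x s)
    rw [hM none] at h₁
    simpa [code, stackOf, h0, entry] using h₁
  | @loop_succ r p s _ _ _ _ h0 _ _ ih ih' =>
    have h₁ := StepsTo.one (M := M) (l := emb none) (v := none) (S := stackOf x s)
    rw [hM none] at h₁
    obtain ⟨n, hn⟩ := Nat.exists_eq_succ_of_ne_zero h0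
    have h₂ : StepsTo M ⟨some (emb none), none, stackOf x s⟩
        ⟨some (emb (some (entry p))), none, stackOf x s⟩ 1 := by
      simpa [code, stackOf, hn, List.replicate_succ] using h₁
    exact (h₂.trans (ih (emb := emb ∘ some) fun l => hM (some l))).trans (ih' hM)

/-! ### The machine -/

/-- The labels of the machine below: the label for reading the next input bit, the halting label,
and the program points of four register programs. -/
abbrev MachineLab (p₀ p₁ p₂ p₃ : Prog ρ) : Type :=
  Bool ⊕ Lab p₀ ⊕ Lab p₁ ⊕ Lab p₂ ⊕ Lab p₃

/-- The machine that first runs `p₀`, then reads the input, running `p₁` for each bit `false` and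
`p₂` for each bit `true`, finally runs `p₃` and halts. -/
def machineCode (p₀ p₁ p₂ p₃ : Prog ρ) : MachineLab p₀ p₁ p₂ p₃ →
    TM2.Stmt (fun _ : Option ρ => Bool) (MachineLab p₀ p₁ p₂ p₃) (Option Bool)
  | .inl true => .pop none (fun _ b => b) <|
      .branch (fun v => v == some true)
        (.load (fun _ => none) (.goto fun _ => .inr (.inr (.inr (.inl (entry p₂)))))) <|
      .branch (fun v => v == some false)
        (.load (fun _ => none) (.goto fun _ => .inr (.inr (.inl (entry p₁)))))
        (.goto fun _ => .inr (.inr (.inr (.inr (entry p₃)))))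
  | .inl false => .halt
  | .inr (.inl l) => code p₀ (fun l => .inr (.inl l)) (.inl true) l
  | .inr (.inr (.inl l)) => code p₁ (fun l => .inr (.inr (.inl l))) (.inl true) l
  | .inr (.inr (.inr (.inl l))) => code p₂ (fun l => .inr (.inr (.inr (.inl l)))) (.inl true) l
  | .inr (.inr (.inr (.inr l))) => code p₃ (fun l => .inr (.inr (.inr (.inr l)))) (.inl false) l

/-- `machineCode` as a bundled machine whose output is the content of the register `out`. -/
noncomputable def machine [Fintype ρ] (p₀ p₁ p₂ p₃ : Prog ρ) (out : ρ) :
    TM2ComputableAux Bool Bool where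
  tm :=
    { K := Option ρ
      k₀ := none
      k₁ := some out
      Γ := fun _ => Bool
      Λ := MachineLab p₀ p₁ p₂ p₃
      main := .inr (.inl (entry p₀))
      σ := Option Bool
      initialState := none
      Γk₀Fin := inferInstanceAs (Fintype Bool)
      m := machineCode p₀ p₁ p₂ p₃ }
  inputAlphabet := Equiv.refl Bool
  outputAlphabet := Equiv.refl Bool

theorem unaryEncodeNat_eq (k : ℕ) : Computability.unaryEncodeNat k = List.replicate k true := by
  induction k with
  | zero => rfl
  | succ k ih => rw [List.replicate_succ, ← ih]; rfl

/-- The number with the binary digits `x`, the least significant digit first. -/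
def bitsVal (x : List Bool) : ℕ := x.foldr Nat.bit 0

theorem testBit_bitsVal (x : List Bool) (t : ℕ) : (bitsVal x).testBit t = x.getD t false := by
  induction x generalizing t with
  | nil => simp [bitsVal]
  | cons b x ih =>
    cases t with
    | zero => simp [bitsVal]
    | succ t => simpa [bitsVal, Nat.testBit_bit_succ] using ih t

theorem bitsVal_lt (x : List Bool) : bitsVal x < 2 ^ x.length := by
  induction x with
  | nil => simp [bitsVal]
  | cons b x ih =>
    have : bitsVal (b :: x) = Nat.bit b (bitsVal x) := rfl
    rw [this, List.length_cons, pow_succ]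
    cases b <;> simp [Nat.bit] <;> omega

/-- While the machine reads the input, it maintains the value `N` of the bits read and the place
value `P` of the next bit. -/
theorem stepsTo_read {p₀ p₁ p₂ p₃ : Prog ρ} {s : ℕ → ℕ → ρ → ℕ} {C : ℕ}
    (h₁ : ∀ N P, ∃ t ≤ C * (P + 1), Runs p₁ (s N P) (s N (2 * P)) t)
    (h₂ : ∀ N P, ∃ t ≤ C * (P + 1), Runs p₂ (s N P) (s (N + P) (2 * P)) t)
    (x : List Bool) (N P : ℕ) :
    ∃ t ≤ x.length * (1 + C * (P * 2 ^ x.length + 1)) + 1,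
      StepsTo (machineCode p₀ p₁ p₂ p₃) ⟨some (.inl true), none, stackOf x (s N P)⟩
        ⟨some (.inr (.inr (.inr (.inr (entry p₃))))), none,
          stackOf [] (s (N + P * bitsVal x) (P * 2 ^ x.length))⟩ t := by
  have hpop : ∀ (y : List Bool) (s : ρ → ℕ),
      Function.update (stackOf y s) none y.tail = stackOf y.tail s := by
    intro y s
    ext1 k
    cases k <;> simp [stackOf]
  induction x generalizing N P with
  | nil =>
    refine ⟨1, by simp, ?_⟩
    have h := StepsTo.one (M := machineCode p₀ p₁ p₂ p₃) (l := .inl true) (v := none)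
      (S := stackOf [] (s N P))
    have h' := hpop [] (s N P)
    simp only [List.tail_nil] at h'
    simpa [machineCode, stackOf, bitsVal, h'] using h
  | cons b x ih =>
    have h := StepsTo.one (M := machineCode p₀ p₁ p₂ p₃) (l := .inl true) (v := none)
      (S := stackOf (b :: x) (s N P))
    have h' := hpop (b :: x) (s N P)
    simp only [List.tail_cons] at h'
    have hpow : 2 * P * 2 ^ x.length = P * 2 ^ (b :: x).length := by
      rw [List.length_cons, pow_succ]; ring
    have hP : P ≤ P * 2 ^ (b :: x).length := Nat.le_mul_of_pos_right P (by positivity)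
    have hbound : ∀ t t' : ℕ, t ≤ C * (P + 1) →
        t' ≤ x.length * (1 + C * (2 * P * 2 ^ x.length + 1)) + 1 → 1 + t + t' ≤
        (b :: x).length * (1 + C * (P * 2 ^ (b :: x).length + 1)) + 1 := by
      intro t t' ht ht'
      rw [hpow] at ht'
      have := Nat.mul_le_mul_left C (Nat.succ_le_succ hP)
      have hl : (b :: x).length = x.length + 1 := rfl
      rw [Nat.succ_eq_add_one, Nat.succ_eq_add_one] at this
      generalize P * 2 ^ (b :: x).length = Q at *
      rw [hl, add_one_mul]
      omega
    cases b with
    | false =>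
      obtain ⟨t, ht, hr⟩ := h₁ N P
      obtain ⟨t', ht', hr'⟩ := ih N (2 * P)
      refine ⟨1 + t + t', hbound t t' ht ht', ?_⟩
      have h₃ : StepsTo (machineCode p₀ p₁ p₂ p₃)
          ⟨some (.inl true), none, stackOf (false :: x) (s N P)⟩
          ⟨some (.inr (.inr (.inl (entry p₁)))), none, stackOf x (s N P)⟩ 1 := by
        simpa [machineCode, stackOf, h'] using h
      have h₄ := (h₃.trans (hr.stepsTo (M := machineCode p₀ p₁ p₂ p₃)
        (emb := fun l => .inr (.inr (.inl l)))
        (exit := .inl true) (fun l => rfl) x)).trans hr'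
      rw [hpow] at h₄
      convert h₄ using 4
      simp [bitsVal, Nat.bit]
      ring
    | true =>
      obtain ⟨t, ht, hr⟩ := h₂ N P
      obtain ⟨t', ht', hr'⟩ := ih (N + P) (2 * P)
      refine ⟨1 + t + t', hbound t t' ht ht', ?_⟩
      have h₃ : StepsTo (machineCode p₀ p₁ p₂ p₃)
          ⟨some (.inl true), none, stackOf (true :: x) (s N P)⟩
          ⟨some (.inr (.inr (.inr (.inl (entry p₂))))), none, stackOf x (s N P)⟩ 1 := by
        simpa [machineCode, stackOf, h'] using h
      have h₄ := (h₃.trans (hr.stepsTo (M := machineCode p₀ p₁ p₂ p₃)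
        (emb := fun l => .inr (.inr (.inr (.inl l))))
        (exit := .inl true) (fun l => rfl) x)).trans hr'
      rw [hpow] at h₄
      convert h₄ using 4
      simp [bitsVal, Nat.bit]
      ring

/-- `Turing.haltList` demands that all stacks but the output stack are empty in the end, hence the
hypothesis on `s`. The additional step executes the halting statement. -/
theorem haltsWithOutput_machine [Fintype ρ] {p₀ p₁ p₂ p₃ : Prog ρ} {out : ρ} {x : List Bool}
    {s : ρ → ℕ} {k t B : ℕ}
    (h : StepsTo (machineCode p₀ p₁ p₂ p₃)
      ⟨some (.inr (.inl (entry p₀))), none, stackOf x fun _ => 0⟩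
      ⟨some (.inl false), none, stackOf [] s⟩ t)
    (hs : ∀ r, s r = if r = out then k else 0) (ht : t + 1 ≤ B) :
    HaltsWithOutput (machine p₀ p₁ p₂ p₃ out) x (Computability.unaryEncodeNat k) B := by
  have h₁ := h.trans (StepsTo.one (M := machineCode p₀ p₁ p₂ p₃))
  refine ⟨⟨⟨t + 1, ?_⟩, ht⟩⟩
  have hinit : Turing.initList (machine p₀ p₁ p₂ p₃ out).tm
      (x.map (machine p₀ p₁ p₂ p₃ out).inputAlphabet.symm) =
      ⟨some (.inr (.inl (entry p₀))), none, stackOf x fun _ => 0⟩ := by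
    unfold Turing.initList
    congr 1
    funext k
    cases k with
    | none =>
      simp only [machine, stackOf]
      exact List.map_id x
    | some r => simp [machine, stackOf]
  have hhalt : Turing.haltList (machine p₀ p₁ p₂ p₃ out).tm
      ((Computability.unaryEncodeNat k).map (machine p₀ p₁ p₂ p₃ out).outputAlphabet.symm) =
      ⟨none, none, stackOf [] s⟩ := by
    unfold Turing.haltList
    congr 1
    funext j
    cases j with
    | none => simp [machine, stackOf]
    | some r =>
      by_cases hr : r = out
      · subst hr; simp [machine, stackOf, hs, unaryEncodeNat_eq]
        rfl
      · simp [machine, stackOf, hs, hr]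
  rw [hinit, Option.map_some, hhalt]
  exact h₁

end Compile

/-- A program uses finitely many registers, so that it can be run on `Fin (R + 1)`. -/
theorem Runs.toFin {p : Prog ℕ} {l l' : List ℕ} {t R : ℕ} (h : Runs p (store l) (store l') t)
    (hp : p.All (· < R + 1)) :
    Runs (p.map (Fin.ofNat (R + 1))) (fun r : Fin (R + 1) => store l r)
      (fun r : Fin (R + 1) => store l' r) t := by
  obtain ⟨S', h₁, h₂, -⟩ := h.map (f := Fin.ofNat (R + 1)) (P := (· < R + 1))
    (fun r r' hr hr' hrr => by
      have := congrArg Fin.val hrr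
      simpa [Nat.mod_eq_of_lt hr, Nat.mod_eq_of_lt hr'] using this) hp
    (S := fun r : Fin (R + 1) => store l r) (fun r hr => by simp [Nat.mod_eq_of_lt hr])
  suffices hS : S' = fun r : Fin (R + 1) => store l' r from hS ▸ h₁
  ext r
  rw [← h₂ r r.isLt]
  simp

/-- Doubles the register `1`, with the registers `2` and `3` as auxiliary registers. -/
def Prog.double : Prog ℕ := .seq (.copy 1 2 3) (.move 2 1)

/-- Adds the register `1` to the register `0` and doubles the register `1`. -/
def Prog.addDouble : Prog ℕ := .seq (.copy 1 0 3) .double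

theorem runs_double (N P : ℕ) :
    Runs .double (store [N, P]) (store [N, 2 * P]) (10 * P + 3) := by
  refine ((runs_copy (r := 1) (d := 2) (a := 3) (by simp) (by simp) (by simp) (store [N, P])
    rfl).seq (runs_move (r := 2) (d := 1) (by simp) _)).cast rfl ?_ ?_
  · have h₁ : store [N, P] = store [N, P, 0] := (store_append_zero [N, P]).symm
    have h₂ : store [N, 2 * P] = store [N, 2 * P, 0] := (store_append_zero [N, 2 * P]).symm
    rw [h₁, h₂, update_store (by simp), update_store (by simp), update_store (by simp)]
    simp [store, two_mul]
  · simp [store]; ring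

theorem runs_addDouble (N P : ℕ) :
    Runs .addDouble (store [N, P]) (store [N + P, 2 * P]) (17 * P + 5) := by
  refine ((runs_copy (r := 1) (d := 0) (a := 3) (by simp) (by simp) (by simp) (store [N, P])
    rfl).seq ((runs_double (N + P) P).cast ?_ rfl rfl)).cast rfl rfl ?_
  · rw [update_store (by simp)]
    simp [store]
  · simp [store]; ring

/-- A function that is computable in quasi-polynomial time in the value of the input bits and in
the power of two to the number of input bits, both in unary, is computed by a machine in exponential
time. -/
theorem QPComputable.exists_machine {f : ℕ × ℕ → ℕ}
    (hf : QPComputable [Prod.fst, Prod.snd] f) :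
    ∃ (T : Turing.TM2ComputableAux Bool Bool) (c : ℕ), ∀ x : List Bool,
      HaltsWithOutput T x (Computability.unaryEncodeNat (f (bitsVal x, 2 ^ x.length)))
        (2 ^ (x.length + 2) ^ c) := by
  obtain ⟨p, T, hT, -, hp⟩ := hf
  -- the result is left in the register `2`; the other registers are cleared
  let q : Prog ℕ := .seq p (.seq (.clear 0) (.clear 1))
  obtain ⟨R', hR'⟩ := (Prog.seq (.inc 1) (.seq .double (.seq .addDouble q))).exists_all_lt
  set R := R' + 2 with hRdef
  have hR := hR'.imp (Q := (· < R + 1)) fun r hr => by omega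
  let tr : Prog ℕ → Prog (Fin (R + 1)) := Prog.map (Fin.ofNat (R + 1))
  let time : List Bool → ℕ := fun x => 1 + (x.length * (1 + 17 * (2 ^ x.length + 1)) + 1) +
    (T (bitsVal x, 2 ^ x.length) + ((2 * bitsVal x + 1) + (2 * 2 ^ x.length + 1))) + 1
  have hquasi : QuasiPoly [fun x : List Bool => 2 ^ x.length] time := by
    have h₁ : QuasiPoly [fun x : List Bool => 2 ^ x.length] fun x => 2 ^ x.length :=
      .arg (by simp)
    have h₂ : QuasiPoly [fun x : List Bool => 2 ^ x.length] bitsVal :=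
      h₁.of_le fun x => (bitsVal_lt x).le
    have h₃ : QuasiPoly [fun x : List Bool => 2 ^ x.length]
        fun x => T (bitsVal x, 2 ^ x.length) :=
      hT.comp (φ := fun x => (bitsVal x, 2 ^ x.length)) (by simpa using ⟨h₂, h₁⟩)
    have h₄ : QuasiPoly [fun x : List Bool => 2 ^ x.length] fun x => x.length :=
      h₁.of_le fun x => Nat.lt_two_pow_self.le
    exact (((QuasiPoly.const 1).add ((h₄.mul ((QuasiPoly.const 1).add ((QuasiPoly.const 17).mul
      (h₁.add (.const 1))))).add (.const 1))).add
      (h₃.add ((((QuasiPoly.const 2).mul h₂).add (.const 1)).add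
        (((QuasiPoly.const 2).mul h₁).add (.const 1))))).add (.const 1)
  obtain ⟨c, hc⟩ := hquasi
  refine ⟨machine (tr (.inc 1)) (tr .double) (tr .addDouble) (tr q) (Fin.ofNat (R + 1) 2), c,
    fun x => ?_⟩
  obtain ⟨t, ht, hread⟩ := stepsTo_read (p₀ := tr (.inc 1)) (p₁ := tr .double)
    (p₂ := tr .addDouble) (p₃ := tr q) (s := fun N P => fun r : Fin (R + 1) => store [N, P] r)
    (C := 17) (fun N P => ⟨10 * P + 3, by omega, (runs_double N P).toFin hR.2.1⟩)
    (fun N P => ⟨17 * P + 5, by omega, (runs_addDouble N P).toFin hR.2.2.1⟩) x 0 1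
  have hstart : Runs (tr (.inc 1)) (fun r : Fin (R + 1) => store [] r)
      (fun r : Fin (R + 1) => store [0, 1] r) 1 := by
    refine Runs.toFin ((Runs.inc 1 (store [])).cast rfl ?_ rfl) hR.1
    rw [← store_append_zero [], ← store_append_zero ([] ++ [0]), update_store (by simp)]
    simp [store]
  have hq : Runs q (store [bitsVal x, 2 ^ x.length])
      (store [0, 0, f (bitsVal x, 2 ^ x.length)])
      (T (bitsVal x, 2 ^ x.length) + ((2 * bitsVal x + 1) + (2 * 2 ^ x.length + 1))) := by
    refine (hp (bitsVal x, 2 ^ x.length)).seq (((runs_clear 0 _).seq (runs_clear 1 _)).cast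
      rfl ?_ ?_)
    · rw [update_store (by simp [vals]), update_store (by simp [vals])]
      simp [vals]
    · simp [store, vals]
  simp only [one_mul, zero_add] at ht hread
  have hall := ((hstart.stepsTo (M := machineCode (tr (.inc 1)) (tr .double) (tr .addDouble) (tr q))
    (emb := fun l => .inr (.inl l)) (exit := .inl true) (fun _ => rfl) x).trans hread).trans
    (((hq.toFin hR.2.2.2).stepsTo
      (M := machineCode (tr (.inc 1)) (tr .double) (tr .addDouble) (tr q))
      (emb := fun l => .inr (.inr (.inr (.inr l)))) (exit := .inl false) (fun _ => rfl) []))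
  refine haltsWithOutput_machine (k := f (bitsVal x, 2 ^ x.length)) hall ?_ ?_
  · intro r
    have h2 : ((Fin.ofNat (R + 1) 2 : Fin (R + 1)) : ℕ) = 2 := by
      simp [Nat.mod_eq_of_lt (show 2 < R + 1 by omega)]
    have hr : r = Fin.ofNat (R + 1) 2 ↔ (r : ℕ) = 2 := by rw [Fin.ext_iff, h2]
    simp only [hr, store]
    rcases hv : (r : ℕ) with _ | _ | _ | n <;> simp
  · refine le_trans ?_ (hc (x.length + 2) (by omega) x (by
      simpa using Nat.pow_le_pow_right (by omega) (by omega)))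
    simp only [time]
    omega

/-! ### Arithmetic in quasi-polynomial time -/

section Arithmetic

variable {E : Type}

open Classical in
/-- The least `i < n` with `P i`, or `n` if there is none. -/
noncomputable def firstLt (P : ℕ → Prop) (n : ℕ) : ℕ :=
  natFold 0 (fun i a => if a < i then a else if P i then i else i + 1) n

theorem firstLt_succ (P : ℕ → Prop) [DecidablePred P] (n : ℕ) :
    firstLt P (n + 1) = if firstLt P n < n then firstLt P n else if P n then n else n + 1 := by
  simp only [firstLt, natFold]
  congr

theorem firstLt_le (P : ℕ → Prop) (n : ℕ) : firstLt P n ≤ n := by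
  classical
  induction n with
  | zero => simp [firstLt, natFold]
  | succ n ih => rw [firstLt_succ]; split_ifs <;> omega

theorem firstLt_eq {P : ℕ → Prop} {k n : ℕ} (hkn : k < n) (hk : P k) (hlt : ∀ j < k, ¬P j) :
    firstLt P n = k := by
  classical
  have h₁ : ∀ i ≤ k, firstLt P i = i := by
    intro i hi
    induction i with
    | zero => simp [firstLt, natFold]
    | succ i ih =>
      rw [firstLt_succ, ih (by omega), if_neg (lt_irrefl i), if_neg (hlt i (by omega))]
  induction n with
  | zero => omega
  | succ n ih =>
    rcases Nat.lt_succ_iff_lt_or_eq.1 hkn with h | rfl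
    · rw [firstLt_succ, ih h, if_pos h]
    · rw [firstLt_succ, h₁ k le_rfl, if_neg (lt_irrefl k), if_pos hk]

open Classical in
/-- The predicate `P` can be decided from the functions `args` in quasi-polynomial time. -/
def QPDecidable (args : List (E → ℕ)) (P : E → Prop) : Prop :=
  QPComputable args fun e => if P e then 1 else 0

variable {args : List (E → ℕ)}

namespace QPComputable

variable {f g h n x : E → ℕ}

/-- Computations under one additional variable. -/
theorem lift (hf : QPComputable args f) :
    QPComputable (args.map (· ∘ Prod.fst) ++ [fun x : E × ℕ => x.2]) (fun x => f x.1) :=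
  (hf.comap Prod.fst).weaken _

theorem idx : QPComputable (args.map (· ∘ Prod.fst) ++ [fun x : E × ℕ => x.2]) (fun x => x.2) :=
  var (by simp)

theorem idx₂ : QPComputable
    (args.map (· ∘ Prod.fst) ++ [fun x : E × ℕ × ℕ => x.2.1, fun x => x.2.2]) (fun x => x.2.1) :=
  var (by simp)

theorem acc₂ : QPComputable
    (args.map (· ∘ Prod.fst) ++ [fun x : E × ℕ × ℕ => x.2.1, fun x => x.2.2]) (fun x => x.2.2) :=
  var (by simp)

/-- `QPComputable.natFold` for a curried step function. -/
theorem fold {s : E → ℕ → ℕ → ℕ} (hn : QPComputable args n) (hx : QPComputable args x)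
    (hs : QPComputable (args.map (· ∘ Prod.fst) ++ [fun x : E × ℕ × ℕ => x.2.1, fun x => x.2.2])
      fun x => s x.1 x.2.1 x.2.2)
    {b : E → ℕ} (hb : QuasiPoly args b)
    (hle : ∀ e, ∀ i ≤ n e, PTAutomata.natFold (x e) (s e) i ≤ b e) :
    QPComputable args fun e => PTAutomata.natFold (x e) (s e) (n e) :=
  natFold hn hx hs hb hle

theorem of_eq (hf : QPComputable args f) (hfg : ∀ e, f e = g e) : QPComputable args g := by
  rwa [← show f = g from funext hfg]

theorem add (hf : QPComputable args f) (hg : QPComputable args g) :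
    QPComputable args fun e => f e + g e := by
  have key : ∀ x n, PTAutomata.natFold x (fun _ a => a + 1) n = x + n := by
    intro x n
    induction n with
    | zero => rfl
    | succ n ih => rw [PTAutomata.natFold, ih, add_assoc]
  refine (hg.fold hf (s := fun _ _ a => a + 1) acc₂.succ (hf.quasiPoly.add hg.quasiPoly)
    fun e i hi => ?_).of_eq fun e => key _ _
  rw [key]
  omega

theorem pred (hf : QPComputable args f) : QPComputable args fun e => f e - 1 := by
  have key : ∀ n, PTAutomata.natFold 0 (fun i _ => i) n = n - 1 := by
    intro n
    cases n <;> rfl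
  refine (hf.fold zero (s := fun _ i _ => i) idx₂ hf.quasiPoly fun e i hi => ?_).of_eq
    fun e => key _
  rw [key]
  omega

theorem sub (hf : QPComputable args f) (hg : QPComputable args g) :
    QPComputable args fun e => f e - g e := by
  have key : ∀ x n, PTAutomata.natFold x (fun _ a => a - 1) n = x - n := by
    intro x n
    induction n with
    | zero => rfl
    | succ n ih => rw [PTAutomata.natFold, ih, Nat.sub_sub]
  refine (hg.fold hf (s := fun _ _ a => a - 1) acc₂.pred hf.quasiPoly
    fun e i hi => ?_).of_eq fun e => key _ _
  rw [key]
  omega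

theorem mul (hf : QPComputable args f) (hg : QPComputable args g) :
    QPComputable args fun e => f e * g e := by
  have key : ∀ x n, PTAutomata.natFold 0 (fun _ a => a + x) n = x * n := by
    intro x n
    induction n with
    | zero => rfl
    | succ n ih => rw [PTAutomata.natFold, ih, mul_add_one]
  refine (hg.fold zero (s := fun e _ a => a + f e) (acc₂.add hf.lift₂)
    (hf.quasiPoly.mul hg.quasiPoly) fun e i hi => ?_).of_eq fun e => key _ _
  rw [key]
  exact Nat.mul_le_mul_left _ hi

theorem ite_eq_zero (hf : QPComputable args f) (hg : QPComputable args g)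
    (hh : QPComputable args h) : QPComputable args fun e => if f e = 0 then g e else h e := by
  have key : ∀ x y n, PTAutomata.natFold x (fun _ _ => y) n = if n = 0 then x else y := by
    intro x y n
    cases n <;> rfl
  refine (hf.fold hg (s := fun e _ _ => h e) hh.lift₂ (hg.quasiPoly.add hh.quasiPoly)
    fun e i hi => ?_).of_eq fun e => key _ _ _
  rw [key]
  split_ifs <;> omega

end QPComputable

namespace QPDecidable

open Classical

variable {P Q : E → Prop} {f g n : E → ℕ}

theorem of_iff (hP : QPDecidable args P) (h : ∀ e, P e ↔ Q e) : QPDecidable args Q := by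
  rwa [← show P = Q from funext fun e => propext (h e)]

theorem eq_zero (hf : QPComputable args f) : QPDecidable args fun e => f e = 0 :=
  (hf.ite_eq_zero (.const 1) .zero).of_eq fun e => by congr

theorem not (hP : QPDecidable args P) : QPDecidable args fun e => ¬P e :=
  (eq_zero hP).of_iff fun e => by simp

theorem and (hP : QPDecidable args P) (hQ : QPDecidable args Q) :
    QPDecidable args fun e => P e ∧ Q e :=
  (QPComputable.mul hP hQ).of_eq fun e => by by_cases h : P e <;> by_cases h' : Q e <;> simp [h, h']

theorem or (hP : QPDecidable args P) (hQ : QPDecidable args Q) :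
    QPDecidable args fun e => P e ∨ Q e :=
  (hP.not.and hQ.not).not.of_iff fun e => by tauto

theorem imp (hP : QPDecidable args P) (hQ : QPDecidable args Q) :
    QPDecidable args fun e => P e → Q e :=
  (hP.not.or hQ).of_iff fun e => by tauto

theorem iff (hP : QPDecidable args P) (hQ : QPDecidable args Q) :
    QPDecidable args fun e => (P e ↔ Q e) :=
  ((hP.imp hQ).and (hQ.imp hP)).of_iff fun e => by tauto

theorem le (hf : QPComputable args f) (hg : QPComputable args g) :
    QPDecidable args fun e => f e ≤ g e :=
  (eq_zero (hf.sub hg)).of_iff fun e => by omega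

theorem lt (hf : QPComputable args f) (hg : QPComputable args g) :
    QPDecidable args fun e => f e < g e :=
  le hf.succ hg

theorem eq (hf : QPComputable args f) (hg : QPComputable args g) :
    QPDecidable args fun e => f e = g e :=
  ((le hf hg).and (le hg hf)).of_iff fun e => by omega

theorem lift₂ {P : E → ℕ → Prop}
    (hP : QPDecidable (args.map (· ∘ Prod.fst) ++ [fun x : E × ℕ => x.2]) fun x => P x.1 x.2) :
    QPDecidable (args.map (· ∘ Prod.fst) ++ [fun x : E × ℕ × ℕ => x.2.1, fun x => x.2.2])
      fun x => P x.1 x.2.1 := by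
  have := (QPComputable.comap (fun x : E × ℕ × ℕ => (x.1, x.2.1)) hP).weaken [fun x => x.2.2]
  simp only [List.map_append, List.map_map, List.append_assoc, List.map_cons, List.map_nil,
    List.cons_append, List.nil_append] at this
  exact this

theorem forall_lt {P : E → ℕ → Prop} (hn : QPComputable args n)
    (hP : QPDecidable (args.map (· ∘ Prod.fst) ++ [fun x : E × ℕ => x.2]) fun x => P x.1 x.2) :
    QPDecidable args fun e => ∀ i < n e, P e i := by
  have key : ∀ e n, natFold 1 (fun i a => a * if P e i then 1 else 0) n =
      if ∀ i < n, P e i then 1 else 0 := by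
    intro e n
    induction n with
    | zero => simp [natFold]
    | succ n ih =>
      rw [natFold, ih]
      simp only [Nat.forall_lt_succ_right]
      by_cases h : P e n <;> simp [h]
  refine (hn.fold (.const 1) (s := fun e i a => a * if P e i then 1 else 0)
    (QPComputable.acc₂.mul hP.lift₂) (.const 1) fun e i hi => ?_).of_eq fun e => by rw [key]; congr
  rw [key]
  split_ifs <;> simp

end QPDecidable

namespace QPComputable

open Classical

variable {f g h n x : E → ℕ}

theorem ite {P : E → Prop} [∀ e, Decidable (P e)] (hP : QPDecidable args P)
    (hg : QPComputable args g) (hh : QPComputable args h) :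
    QPComputable args fun e => if P e then g e else h e :=
  (ite_eq_zero hP hh hg).of_eq fun e => by by_cases h : P e <;> simp [h]

theorem firstLt {P : E → ℕ → Prop} (hn : QPComputable args n)
    (hP : QPDecidable (args.map (· ∘ Prod.fst) ++ [fun x : E × ℕ => x.2]) fun x => P x.1 x.2) :
    QPComputable args fun e => PTAutomata.firstLt (P e) (n e) :=
  hn.fold zero (s := fun e i a => if a < i then a else if P e i then i else i + 1)
    (ite (.lt acc₂ idx₂) acc₂ (ite hP.lift₂ idx₂ idx₂.succ)) hn.quasiPoly
    fun _ _ hi => (firstLt_le _ _).trans hi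

theorem div (hf : QPComputable args f) (hg : QPComputable args g) :
    QPComputable args fun e => f e / g e := by
  refine (firstLt (P := fun e q => g e = 0 ∨ f e < (q + 1) * g e) hf.succ
    ((QPDecidable.eq_zero hg.lift).or (.lt hf.lift (idx.succ.mul hg.lift)))).of_eq fun e => ?_
  refine firstLt_eq (Nat.lt_succ_of_le (Nat.div_le_self _ _)) ?_ fun j hj => ?_
  · rcases Nat.eq_zero_or_pos (g e) with h | h
    · exact Or.inl h
    · exact Or.inr ((Nat.div_lt_iff_lt_mul h).1 (Nat.lt_succ_self _))
  · rintro (h | h)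
    · simp [h] at hj
    · have h0 : 0 < g e := Nat.pos_of_ne_zero fun h0 => by simp [h0] at hj
      have := (Nat.div_lt_iff_lt_mul h0).2 h
      omega

theorem mod (hf : QPComputable args f) (hg : QPComputable args g) :
    QPComputable args fun e => f e % g e :=
  (hf.sub (hg.mul (hf.div hg))).of_eq fun _ => (Nat.mod_eq_sub _ _).symm

/-- The power need not be computed: one divides repeatedly. -/
theorem div_pow (hf : QPComputable args f) (hg : QPComputable args g) (hn : QPComputable args n) :
    QPComputable args fun e => f e / g e ^ n e := by
  have key : ∀ x b n, PTAutomata.natFold x (fun _ a => a / b) n = x / b ^ n := by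
    intro x b n
    induction n with
    | zero => simp [PTAutomata.natFold]
    | succ n ih => rw [PTAutomata.natFold, ih, Nat.div_div_eq_div_mul, pow_succ]
  refine (hn.fold hf (s := fun e _ a => a / g e) (acc₂.div hg.lift₂) hf.quasiPoly
    fun _ _ _ => ?_).of_eq fun e => key _ _ _
  rw [key]
  exact Nat.div_le_self _ _

/-- The digit at place `n`, counted from the least significant one, in base `g`. -/
theorem digit (hf : QPComputable args f) (hg : QPComputable args g) (hn : QPComputable args n) :
    QPComputable args fun e => f e / g e ^ n e % g e :=
  (hf.div_pow hg hn).mod hg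

end QPComputable

end Arithmetic

/-! ### Reading an automaton from its code -/

section Decoding

/-- The length of the block of ones that starts at the bit `p` of `N`, that is, the
number whose code begins there. -/
noncomputable def tok (N p : ℕ) : ℕ := firstLt (fun d => N / 2 ^ (p + d) % 2 = 0) (N + 1)

/-- The position reached from the bit `p` by skipping `a` codes of numbers. -/
noncomputable def scan (N p a : ℕ) : ℕ := natFold p (fun _ p => p + tok N p + 1) a

/-- The number of states of the automaton with code `N`. -/
noncomputable def numStates (N : ℕ) : ℕ := tok N 0

/-- The number of letters of the automaton with code `N`. -/
noncomputable def numLetters (N : ℕ) : ℕ := tok N (numStates N + 1)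

/-- The initial state of the automaton with code `N`. -/
noncomputable def startState (N : ℕ) : ℕ := tok N (numStates N + numLetters N + 2)

/-- The position of the bit that tells whether the state `q` is accepting. -/
noncomputable def rowPos (N q : ℕ) : ℕ :=
  natFold (numStates N + numLetters N + startState N + 3)
    (fun _ p => scan N (p + 1) (numLetters N)) q

/-- The transition function of the automaton with code `N`. -/
noncomputable def stepCode (N q a : ℕ) : ℕ := tok N (scan N (rowPos N q + 1) a)

theorem length_codeNat (i : ℕ) : (codeNat i).length = i + 1 := by simp [codeNat]

theorem bit_eq_zero_iff (x : List Bool) (t : ℕ) :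
    bitsVal x / 2 ^ t % 2 = 0 ↔ x.getD t false = false := by
  rw [← testBit_bitsVal, Nat.testBit_eq_decide_div_mod_eq, decide_eq_false_iff_not]
  omega

/-- Reading the code of a number. The search bound in `tok` suffices since `N` is at least the
number of its ones. -/
theorem tok_eq {x rest : List Bool} {p v : ℕ} (h : x.drop p = codeNat v ++ rest) :
    tok (bitsVal x) p = v ∧ x.drop (p + v + 1) = rest := by
  have hget : ∀ d, x.getD (p + d) false = (codeNat v ++ rest).getD d false := by
    intro d
    rw [← h]
    simp
  have hone : ∀ j < v, ¬bitsVal x / 2 ^ (p + j) % 2 = 0 := by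
    intro j hj
    rw [bit_eq_zero_iff, hget]
    simp [codeNat, List.getElem?_append, hj]
  constructor
  · refine firstLt_eq ?_ ?_ hone
    · rcases Nat.eq_zero_or_pos v with rfl | hv
      · exact Nat.succ_pos _
      · have h₁ := hone (v - 1) (by omega)
        have h₂ : 2 ^ (v - 1) ≤ 2 ^ (p + (v - 1)) := Nat.pow_le_pow_right (by omega) (by omega)
        have h₃ : v - 1 < 2 ^ (v - 1) := Nat.lt_two_pow_self
        have h₄ : ¬bitsVal x < 2 ^ (p + (v - 1)) := fun hlt => h₁ (by rw [Nat.div_eq_of_lt hlt])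
        omega
    · rw [bit_eq_zero_iff, hget]
      simp [codeNat]
  · rw [add_assoc, ← List.drop_drop, h]
    exact List.drop_left' (length_codeNat v)

theorem drop_scan {x rest : List Bool} {p : ℕ} {l : List ℕ}
    (h : x.drop p = l.flatMap codeNat ++ rest) {a : ℕ} (ha : a ≤ l.length) :
    x.drop (scan (bitsVal x) p a) = (l.drop a).flatMap codeNat ++ rest := by
  induction a with
  | zero => simpa [scan, natFold] using h
  | succ a ih =>
    have h₁ := ih (by omega)
    rw [List.drop_eq_getElem_cons (l := l) (by omega), List.flatMap_cons, List.append_assoc] at h₁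
    obtain ⟨h₂, h₃⟩ := tok_eq h₁
    rw [← h₃]
    simp only [scan, natFold] at h₂ ⊢
    rw [h₂]

variable {n m : ℕ} (M : DFA (Fin m) (Fin n))

open Classical in
/-- The part of the code of an automaton that belongs to the state `q`. -/
noncomputable def codeRow (q : Fin n) : List Bool :=
  decide (q ∈ M.accept) :: (List.finRange m).flatMap fun a => codeNat (M.step q a)

theorem codeDFA_header : numStates (bitsVal (codeDFA M)) = n ∧
    numLetters (bitsVal (codeDFA M)) = m ∧ startState (bitsVal (codeDFA M)) = M.start ∧
    (codeDFA M).drop (n + m + M.start + 3) = (List.finRange n).flatMap (codeRow M) := by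
  have h₀ : (codeDFA M).drop 0 = codeNat n ++ (codeNat m ++ (codeNat M.start ++
      (List.finRange n).flatMap (codeRow M))) := by
    simp only [List.drop_zero, codeDFA, List.append_assoc]
    rfl
  obtain ⟨h₁, h₂⟩ := tok_eq h₀
  rw [zero_add] at h₂
  obtain ⟨h₃, h₄⟩ := tok_eq h₂
  rw [show n + 1 + m + 1 = n + m + 2 by ring] at h₄
  obtain ⟨h₅, h₆⟩ := tok_eq h₄
  rw [show n + m + 2 + (M.start : ℕ) + 1 = n + m + M.start + 3 by ring] at h₆
  have e₁ : numStates (bitsVal (codeDFA M)) = n := h₁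
  have e₂ : numLetters (bitsVal (codeDFA M)) = m := by rw [numLetters, e₁, h₃]
  exact ⟨e₁, e₂, by rw [startState, e₁, e₂, h₅], h₆⟩

theorem drop_transitions {q : Fin n} {p : ℕ}
    (h : (codeDFA M).drop p = ((List.finRange n).drop q).flatMap (codeRow M)) :
    (codeDFA M).drop (p + 1) =
      ((List.finRange m).map fun a => (M.step q a : ℕ)).flatMap codeNat ++
        ((List.finRange n).drop (q + 1)).flatMap (codeRow M) := by
  rw [← List.drop_drop, h, List.drop_eq_getElem_cons (l := List.finRange n) (by simp)]
  simp [codeRow, List.flatMap_map]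

theorem drop_rowPos {q : ℕ} (hq : q ≤ n) : (codeDFA M).drop (rowPos (bitsVal (codeDFA M)) q) =
    ((List.finRange n).drop q).flatMap (codeRow M) := by
  obtain ⟨h₁, h₂, h₃, h₄⟩ := codeDFA_header M
  induction q with
  | zero => rw [rowPos, h₁, h₂, h₃]; exact h₄
  | succ q ih =>
    have h₅ := drop_scan (drop_transitions M (q := ⟨q, hq⟩) (ih (by omega))) (a := m) (by simp)
    simp only [List.drop_of_length_le
      (show (List.map (fun a => (M.step ⟨q, hq⟩ a : ℕ)) (List.finRange m)).length ≤ m by simp),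
      List.flatMap_nil, List.nil_append] at h₅
    rw [← h₅]
    simp only [rowPos, natFold, h₂]

theorem stepCode_eq (q : Fin n) (a : Fin m) :
    stepCode (bitsVal (codeDFA M)) q a = M.step q a := by
  have h := drop_scan (drop_transitions M (drop_rowPos M q.isLt.le)) (a := a) (by simp)
  rw [List.drop_eq_getElem_cons (l := List.map _ _) (by simp), List.flatMap_cons,
    List.append_assoc] at h
  rw [stepCode, (tok_eq h).1]
  simp

theorem le_length_codeDFA : n + m + 2 ≤ (codeDFA M).length := by
  simp only [codeDFA, List.length_append, length_codeNat]
  omega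

theorem length_codeDFA_le : (codeDFA M).length ≤ (n + m) ^ 3 + 3 * (n + m) + 2 := by
  have hrow : ∀ q, (codeRow M q).length ≤ 1 + m * n := by
    intro q
    simp only [codeRow, List.length_cons, List.length_flatMap, length_codeNat]
    have := List.sum_le_card_nsmul ((List.finRange m).map fun a => (M.step q a : ℕ) + 1) n
      (by simp)
    simp at this ⊢
    omega
  have hrows : ((List.finRange n).flatMap (codeRow M)).length ≤ n * (1 + m * n) := by
    rw [List.length_flatMap]
    have := List.sum_le_card_nsmul ((List.finRange n).map fun q => (codeRow M q).length)
      (1 + m * n) (by simpa using hrow)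
    simpa using this
  have : (codeDFA M).length = n + 1 + (m + 1) + (M.start + 1) +
      ((List.finRange n).flatMap (codeRow M)).length := by
    simp only [codeDFA, List.length_append, length_codeNat]
    rfl
  have hs := M.start.isLt
  nlinarith [Nat.zero_le (m ^ 3), Nat.zero_le (n ^ 3), Nat.zero_le (m ^ 2 * n),
    Nat.zero_le (m * n ^ 2)]

end Decoding

/-! ### Words as numbers -/

section Words

theorem natFold_succ_left (x : ℕ) (s : ℕ → ℕ → ℕ) (n : ℕ) :
    natFold x s (n + 1) = natFold (s 0 x) (fun t => s (t + 1)) n := by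
  induction n with
  | zero => rfl
  | succ n ih => rw [natFold, ih, natFold]

/-- Recursion along the digits of a number `U`, the least significant digit first. The number of
rounds may exceed the number of digits, since further digits are zero. -/
theorem natFold_digits {b : ℕ} (hb : 1 < b) (F : ℕ → ℕ → ℕ) (hF : ∀ a, F 0 a = a) {T U x : ℕ}
    (hT : U ≤ T) : natFold x (fun t a => F (U / b ^ t % b) a) T =
      (Nat.digits b U).foldl (fun a d => F d a) x := by
  induction T generalizing U x with
  | zero => obtain rfl : U = 0 := by omega
            simp [natFold]
  | succ T ih =>
    rw [natFold_succ_left]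
    have hdiv : ∀ t, U / b ^ (t + 1) = U / b / b ^ t := fun t => by
      rw [Nat.div_div_eq_div_mul, pow_succ']
    simp only [hdiv, pow_zero, Nat.div_one]
    rcases Nat.eq_zero_or_pos U with rfl | hU
    · rw [Nat.zero_div, ih (Nat.zero_le T)]
      simp [hF]
    · have := Nat.div_lt_self hU hb
      rw [ih (by omega), Nat.digits_def' hb hU]
      rfl

/-- One step of the greedy search for the digits of `r` as a subword: the digit `d` is read. Blanks
(zero digits) are skipped. -/
def consume (b d r : ℕ) : ℕ := if d = 0 then r else if r % b = d then r / b else r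

theorem foldl_consume_eq_zero_iff {b : ℕ} (hb : 1 < b) (ds : List ℕ) (Z : ℕ) :
    ds.foldl (fun r d => consume b d r) Z = 0 ↔
      (Nat.digits b Z).Sublist (ds.filter (· ≠ 0)) := by
  induction ds generalizing Z with
  | nil => simp [Nat.digits_eq_nil_iff_eq_zero]
  | cons d ds ih =>
    rw [List.foldl_cons, ih]
    by_cases hd : d = 0
    · simp [hd, consume]
    · rw [List.filter_cons_of_pos (by simpa using hd)]
      rcases Nat.eq_zero_or_pos Z with rfl | hZ
      · simp [consume, Ne.symm hd]
      · by_cases hZd : Z % b = d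
        · rw [Nat.digits_def' hb hZ, hZd, List.cons_sublist_cons]
          simp [consume, hd, hZd]
        · have : consume b d Z = Z := by simp [consume, hZd]
          rw [this, Nat.digits_def' hb hZ]
          refine ⟨fun h => h.cons d, fun h => ?_⟩
          cases h with
          | cons _ h => exact h
          | cons_cons _ h => exact absurd rfl hZd

variable {m : ℕ}

/-- The word described by a number in base `m + 1`: the digit `0` is a blank and the digit `a + 1`
stands for the letter `a`. -/
def wordOf (m U : ℕ) : List (Fin m) :=
  (Nat.digits (m + 1) U).filterMap fun d =>
    if h : d - 1 < m ∧ d ≠ 0 then some ⟨d - 1, h.1⟩ else none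

/-- The number that describes a word. -/
def numOf (u : List (Fin m)) : ℕ := Nat.ofDigits (m + 1) (u.map fun a : Fin m => (a : ℕ) + 1)

theorem map_filterMap_letters {ds : List ℕ} (h : ∀ d ∈ ds, d < m + 1) :
    (ds.filterMap fun d => if h : d - 1 < m ∧ d ≠ 0 then some (⟨d - 1, h.1⟩ : Fin m) else none).map
      (fun a : Fin m => (a : ℕ) + 1) = ds.filter (· ≠ 0) := by
  induction ds with
  | nil => rfl
  | cons d ds ih =>
    have hd := h d List.mem_cons_self
    have ih := ih fun d hd => h d (List.mem_cons_of_mem _ hd)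
    by_cases h0 : d = 0
    · simpa [h0] using ih
    · rw [List.filterMap_cons_some (b := ⟨d - 1, by omega⟩) (by simp [h0]; omega), List.map_cons,
        ih, List.filter_cons_of_pos (by simpa using h0)]
      simp only [List.cons.injEq, and_true]
      omega

theorem map_wordOf (U : ℕ) (hm : 0 < m) :
    (wordOf m U).map (fun a : Fin m => (a : ℕ) + 1) = (Nat.digits (m + 1) U).filter (· ≠ 0) :=
  map_filterMap_letters fun _ hd => Nat.digits_lt_base (by omega) hd

theorem digits_numOf (u : List (Fin m)) (hm : 0 < m) :
    Nat.digits (m + 1) (numOf u) = u.map fun a : Fin m => (a : ℕ) + 1 := by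
  refine Nat.digits_ofDigits _ (by omega) _ (by simp) fun h => ?_
  rw [List.getLast_map]
  omega

theorem map_letters_injective : Function.Injective fun a : Fin m => (a : ℕ) + 1 := by
  intro a b h
  simpa [Fin.ext_iff] using h

theorem wordOf_numOf (u : List (Fin m)) (hm : 0 < m) : wordOf m (numOf u) = u := by
  refine List.map_injective_iff.2 map_letters_injective ?_
  rw [map_wordOf _ hm, digits_numOf u hm, List.filter_eq_self]
  simp

theorem numOf_lt {u : List (Fin m)} {k : ℕ} (hu : u.length ≤ k) (hm : 0 < m) :
    numOf u < (m + 1) ^ k := by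
  rw [← Nat.digits_length_le_iff (by omega), digits_numOf u hm]
  simpa

end Words

/-! ### The algorithm -/

section Algorithm

/-- The state that the automaton with code `N` reaches on the word with number `U`. -/
noncomputable def runCode (N U : ℕ) : ℕ :=
  natFold (startState N) (fun t q =>
    if U / (numLetters N + 1) ^ t % (numLetters N + 1) = 0 then q
    else stepCode N q (U / (numLetters N + 1) ^ t % (numLetters N + 1) - 1)) U

/-- What the greedy search in the word with number `U` leaves of the word with number `Z`. -/
def remCode (b Z U : ℕ) : ℕ := natFold Z (fun t r => consume b (U / b ^ t % b) r) U

/-- A number that exceeds the numbers of all relevant words, where `P = 2 ^ L` for the length `L` of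
the code of the automaton. It is chosen as a power of two with an exponent polynomial in `L` that
bounds the number of binary digits of the words in question, see `pow_le_searchBound`. -/
def searchBound (P : ℕ) : ℕ := 2 ^ (7 * P.size ^ 3)

/-- The brute-force test for `k`-piecewise testability: all pairs of words with numbers below the
bound are inspected. The numbers `Z` run through the words of length at most `k`. -/
def BoundedTest (N P k : ℕ) : Prop :=
  ∀ U < searchBound P, ∀ V < searchBound P,
    (∀ Z < searchBound P, Z / (numLetters N + 1) ^ k = 0 →
      (remCode (numLetters N + 1) Z U = 0 ↔ remCode (numLetters N + 1) Z V = 0)) →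
    runCode N U = runCode N V

/-- The output of the algorithm, given the code of the automaton as a number and the power of two
to its length. -/
noncomputable def leastTest (NP : ℕ × ℕ) : ℕ :=
  firstLt (fun k => BoundedTest NP.1 NP.2 k) (searchBound NP.2)

variable {n m : ℕ} (M : DFA (Fin m) (Fin n))

theorem runCode_eq (hm : 0 < m) (U : ℕ) :
    runCode (bitsVal (codeDFA M)) U = M.eval (wordOf m U) := by
  obtain ⟨-, h₂, h₃, -⟩ := codeDFA_header M
  rw [runCode, h₂, h₃, natFold_digits (by omega)
    (fun d q => if d = 0 then q else stepCode (bitsVal (codeDFA M)) q (d - 1)) (by simp) le_rfl]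
  have hlt : ∀ d ∈ Nat.digits (m + 1) U, d < m + 1 := fun d hd => Nat.digits_lt_base (by omega) hd
  unfold wordOf DFA.eval
  generalize Nat.digits (m + 1) U = ds at hlt
  generalize M.start = q
  induction ds generalizing q with
  | nil => rfl
  | cons d ds ih =>
    have hd := hlt d List.mem_cons_self
    have ih := ih fun d hd => hlt d (List.mem_cons_of_mem _ hd)
    by_cases h0 : d = 0
    · simpa [h0] using ih q
    · rw [List.filterMap_cons_some (b := ⟨d - 1, by omega⟩) (by simp [h0]; omega),
        DFA.evalFrom_cons, ← ih, List.foldl_cons, if_neg h0, ← stepCode_eq]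

theorem remCode_eq_zero_iff (hm : 0 < m) (Z U : ℕ) : remCode (m + 1) Z U = 0 ↔
    (Nat.digits (m + 1) Z).Sublist ((wordOf m U).map fun a : Fin m => (a : ℕ) + 1) := by
  rw [remCode, natFold_digits (by omega) (consume (m + 1)) (by simp [consume]) le_rfl,
    foldl_consume_eq_zero_iff (by omega), map_wordOf U hm]

theorem sublist_iff_remCode (hm : 0 < m) (z : List (Fin m)) (U : ℕ) :
    z.Sublist (wordOf m U) ↔ remCode (m + 1) (numOf z) U = 0 := by
  rw [remCode_eq_zero_iff hm, digits_numOf z hm]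
  refine ⟨fun h => h.map _, fun h => ?_⟩
  obtain ⟨z', h₁, h₂⟩ := List.sublist_map_iff.1 h
  rwa [List.map_injective_iff.2 map_letters_injective h₂]

theorem remCode_iff_of_subEquiv (hm : 0 < m) {k Z U V : ℕ}
    (h : SubEquiv k (wordOf m U) (wordOf m V)) (hZ : Z < (m + 1) ^ k) :
    remCode (m + 1) Z U = 0 ↔ remCode (m + 1) Z V = 0 := by
  have hlen := (Nat.digits_length_le_iff (b := m + 1) (by omega) Z).2 hZ
  rw [remCode_eq_zero_iff hm, remCode_eq_zero_iff hm]
  constructor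
  · intro hs
    obtain ⟨z, h₁, h₂⟩ := List.sublist_map_iff.1 hs
    rw [h₂] at hlen ⊢
    exact ((h z (by simpa using hlen)).1 h₁).map _
  · intro hs
    obtain ⟨z, h₁, h₂⟩ := List.sublist_map_iff.1 hs
    rw [h₂] at hlen ⊢
    exact ((h z (by simpa using hlen)).2 h₁).map _

/-- All words of the lengths that occur in `IsConfluent.eval_eq_of_short` are inspected. -/
theorem pow_le_searchBound {L B : ℕ} (hL : n + m + 2 ≤ L)
    (hB : B ≤ (3 * n + 2) * (2 * n + m) + 1) : (m + 1) ^ B ≤ searchBound (2 ^ L) := by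
  have h₁ : m + 1 ≤ 2 ^ m := Nat.lt_two_pow_self
  refine (Nat.pow_le_pow_left h₁ B).trans ?_
  rw [← pow_mul, searchBound, Nat.size_pow]
  refine Nat.pow_le_pow_right (by omega) ?_
  obtain ⟨S, hS⟩ : ∃ S, S = L + 1 := ⟨_, rfl⟩
  rw [← hS]
  have h₂ : (3 * n + 2) * (2 * n + m) ≤ (3 * S) * (2 * S) :=
    Nat.mul_le_mul (by omega) (by omega)
  have h₃ : 1 ≤ S * S := Nat.mul_pos (by omega) (by omega)
  have h₄ : B ≤ 7 * (S * S) := by nlinarith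
  calc m * B ≤ S * (7 * (S * S)) := Nat.mul_le_mul (by omega) h₄
    _ = 7 * S ^ 3 := by ring

/-- For `k ≤ 3 n` the brute-force test is correct. -/
theorem boundedTest_iff (hm : 0 < m) (hmin : IsMinimal M) (hM : IsPartiallyOrdered M)
    (hC : IsConfluent M) {k : ℕ} (hk : k ≤ 3 * n) :
    BoundedTest (bitsVal (codeDFA M)) (2 ^ (codeDFA M).length) k ↔
      IsPiecewiseTestable k M.accepts := by
  obtain ⟨-, h₂, -, -⟩ := codeDFA_header M
  have hL := le_length_codeDFA M
  have hn := M.start.pos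
  rw [hmin.isPiecewiseTestable_iff]
  unfold BoundedTest
  rw [h₂]
  constructor
  · intro h u v huv
    refine hC.eval_eq_of_short hM (B := (3 * n + 2) * (2 * n + m) + 1) (by simp)
      (fun u v hu hv huv => ?_) huv
    have hb := pow_le_searchBound hL (le_refl ((3 * n + 2) * (2 * n + m) + 1))
    have := h (numOf u) ((numOf_lt hu hm).trans_le hb) (numOf v) ((numOf_lt hv hm).trans_le hb)
      fun Z _ hZ => remCode_iff_of_subEquiv (k := k) hm
        (by rwa [wordOf_numOf u hm, wordOf_numOf v hm])
        ((Nat.div_eq_zero_iff_lt (by positivity)).1 hZ)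
    rw [runCode_eq M hm, runCode_eq M hm, wordOf_numOf u hm, wordOf_numOf v hm] at this
    exact Fin.ext this
  · intro h U _ V _ hZ
    have hb := pow_le_searchBound (B := k) hL (by nlinarith)
    rw [runCode_eq M hm, runCode_eq M hm]
    refine congrArg _ (h _ _ fun z hz => ?_)
    have hz' := numOf_lt hz hm
    rw [sublist_iff_remCode hm, sublist_iff_remCode hm]
    exact hZ _ (hz'.trans_le hb) (Nat.div_eq_of_lt hz')

theorem exists_isLeast (hmin : IsMinimal M) (hM : IsPartiallyOrdered M) (hC : IsConfluent M) :
    ∃ k ≤ 3 * n, IsLeast {j : ℕ | IsPiecewiseTestable j M.accepts} k := by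
  classical
  have h : IsPiecewiseTestable (3 * n) M.accepts :=
    hmin.isPiecewiseTestable_iff.2 fun u v huv => hC.eval_eq_of_subEquiv hM (by simpa using huv)
  exact ⟨Nat.find ⟨_, h⟩, Nat.find_min' _ h, Nat.find_spec ⟨_, h⟩, fun j hj => Nat.find_min' _ hj⟩

theorem leastTest_eq (hm : 0 < m) (hmin : IsMinimal M) (hM : IsPartiallyOrdered M)
    (hC : IsConfluent M) {k : ℕ} (hk : k ≤ 3 * n)
    (hleast : IsLeast {j : ℕ | IsPiecewiseTestable j M.accepts} k) :
    leastTest (bitsVal (codeDFA M), 2 ^ (codeDFA M).length) = k := by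
  refine firstLt_eq ?_ ((boundedTest_iff M hm hmin hM hC hk).2 hleast.1) fun j hj h => ?_
  · have hb := pow_le_searchBound (B := k) (le_length_codeDFA M)
      (by have := M.start.pos; nlinarith)
    have h₁ : k < 2 ^ k := Nat.lt_two_pow_self
    have h₂ : 2 ^ k ≤ (m + 1) ^ k := Nat.pow_le_pow_left (by omega) k
    exact (h₁.trans_le h₂).trans_le hb
  · exact absurd (hleast.2 ((boundedTest_iff M hm hmin hM hC (by omega)).1 h)) (by omega)

/-! ### The algorithm runs in exponential time -/

theorem scan_le (N p a : ℕ) : scan N p a ≤ p + a * (N + 2) := by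
  induction a with
  | zero => simp [scan, natFold]
  | succ a ih =>
    have : tok N (scan N p a) ≤ N + 1 := firstLt_le _ _
    have h : scan N p (a + 1) = scan N p a + tok N (scan N p a) + 1 := rfl
    rw [h, add_one_mul]
    omega

variable {E : Type} {args : List (E → ℕ)} {f g h : E → ℕ}

namespace QPComputable

theorem tok (hf : QPComputable args f) (hg : QPComputable args g) :
    QPComputable args fun e => tok (f e) (g e) :=
  hf.succ.firstLt (P := fun e d => f e / 2 ^ (g e + d) % 2 = 0)
    (.eq_zero (hf.lift.digit (.const 2) (hg.lift.add idx)))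

theorem scan (hf : QPComputable args f) (hg : QPComputable args g) (hh : QPComputable args h) :
    QPComputable args fun e => scan (f e) (g e) (h e) := by
  refine hh.fold hg (s := fun e _ p => p + PTAutomata.tok (f e) p + 1)
    (acc₂.add (hf.lift₂.tok acc₂)).succ
    (hg.quasiPoly.add (hh.quasiPoly.mul (hf.quasiPoly.add (.const 2)))) fun e i hi => ?_
  exact (scan_le (f e) (g e) i).trans (by gcongr)

theorem numStates (hf : QPComputable args f) : QPComputable args fun e => numStates (f e) :=
  hf.tok (.const 0)

theorem numLetters (hf : QPComputable args f) : QPComputable args fun e => numLetters (f e) :=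
  hf.tok hf.numStates.succ

theorem startState (hf : QPComputable args f) : QPComputable args fun e => startState (f e) :=
  hf.tok ((hf.numStates.add hf.numLetters).add (.const 2))

theorem rowPos (hf : QPComputable args f) (hg : QPComputable args g) :
    QPComputable args fun e => rowPos (f e) (g e) := by
  have hx := ((hf.numStates.add hf.numLetters).add hf.startState).add (.const 3)
  refine hg.fold hx
    (s := fun e _ p => PTAutomata.scan (f e) (p + 1) (PTAutomata.numLetters (f e)))
    (hf.lift₂.scan acc₂.succ hf.lift₂.numLetters)
    (hx.quasiPoly.add (hg.quasiPoly.mul ((QuasiPoly.const 1).add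
      (hf.numLetters.quasiPoly.mul (hf.quasiPoly.add (.const 2)))))) fun e i hi => ?_
  have key : ∀ x i, PTAutomata.natFold x (fun _ p => PTAutomata.scan (f e) (p + 1)
      (PTAutomata.numLetters (f e))) i ≤ x + i * (1 + PTAutomata.numLetters (f e) * (f e + 2)) := by
    intro x i
    induction i with
    | zero => simp [PTAutomata.natFold]
    | succ i ih =>
      rw [PTAutomata.natFold, add_one_mul]
      have := scan_le (f e) (PTAutomata.natFold x (fun _ p => PTAutomata.scan (f e) (p + 1)
        (PTAutomata.numLetters (f e))) i + 1) (PTAutomata.numLetters (f e))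
      omega
  exact (key _ i).trans (by gcongr)

theorem stepCode (hf : QPComputable args f) (hg : QPComputable args g) (hh : QPComputable args h) :
    QPComputable args fun e => stepCode (f e) (g e) (h e) :=
  hf.tok (hf.scan (hf.rowPos hg).succ hh)

theorem runCode (hf : QPComputable args f) (hg : QPComputable args g) :
    QPComputable args fun e => runCode (f e) (g e) := by
  have hd := hg.lift₂.digit hf.lift₂.numLetters.succ idx₂
  refine hg.fold hf.startState (s := fun e t q =>
    if g e / (PTAutomata.numLetters (f e) + 1) ^ t % (PTAutomata.numLetters (f e) + 1) = 0 then q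
    else PTAutomata.stepCode (f e) q
      (g e / (PTAutomata.numLetters (f e) + 1) ^ t % (PTAutomata.numLetters (f e) + 1) - 1))
    (hd.ite_eq_zero acc₂ (hf.lift₂.stepCode acc₂ hd.pred)) (hf.quasiPoly.add (.const 1))
    fun e i hi => ?_
  clear hi
  cases i with
  | zero => exact firstLt_le _ _
  | succ i =>
    induction i with
    | zero =>
      simp only [PTAutomata.natFold]
      split_ifs
      exacts [firstLt_le _ _, firstLt_le _ _]
    | succ i ih =>
      rw [PTAutomata.natFold]
      split_ifs
      exacts [ih, firstLt_le _ _]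

theorem consume (hf : QPComputable args f) (hg : QPComputable args g) (hh : QPComputable args h) :
    QPComputable args fun e => consume (f e) (g e) (h e) :=
  hg.ite_eq_zero hh (ite (.eq (hh.mod hf) hg) (hh.div hf) hh)

theorem remCode (hf : QPComputable args f) (hg : QPComputable args g) (hh : QPComputable args h) :
    QPComputable args fun e => remCode (f e) (g e) (h e) := by
  refine hh.fold hg (s := fun e t r => PTAutomata.consume (f e) (h e / f e ^ t % f e) r)
    (hf.lift₂.consume (hh.lift₂.digit hf.lift₂ idx₂) acc₂) hg.quasiPoly fun e i _ => ?_
  induction i with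
  | zero => exact le_rfl
  | succ i ih =>
    rw [PTAutomata.natFold]
    refine le_trans ?_ (ih (by omega))
    unfold PTAutomata.consume
    split_ifs
    exacts [le_rfl, Nat.div_le_self _ _, le_rfl]

theorem size (hf : QPComputable args f) : QPComputable args fun e => (f e).size := by
  refine (hf.succ.firstLt (P := fun e i => f e / 2 ^ i = 0)
    (.eq_zero (hf.lift.div_pow (.const 2) idx))).of_eq fun e => ?_
  have key : ∀ i, f e / 2 ^ i = 0 ↔ (f e).size ≤ i := fun i => by
    rw [Nat.div_eq_zero_iff_lt (by positivity), Nat.size_le]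
  refine firstLt_eq ?_ ((key _).2 le_rfl) fun j hj h => absurd ((key j).1 h) (by omega)
  exact Nat.lt_succ_of_le (Nat.size_le.2 Nat.lt_two_pow_self)

theorem searchBound (hf : QPComputable args f) : QPComputable args fun e => searchBound (f e) := by
  have key : ∀ n, PTAutomata.natFold 1 (fun _ a => a * 2) n = 2 ^ n := by
    intro n
    induction n with
    | zero => rfl
    | succ n ih => rw [PTAutomata.natFold, ih, pow_succ]
  have hb : QuasiPoly args fun e => PTAutomata.searchBound (f e) := by
    obtain ⟨c, hc⟩ := hf.quasiPoly
    refine ⟨3 + (c + 1) * 3, fun ℓ hℓ e he => Nat.pow_le_pow_right (by omega) ?_⟩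
    have h₁ : (f e).size ≤ ℓ ^ c + 1 :=
      Nat.size_le.2 ((hc ℓ hℓ e he).trans_lt (Nat.pow_lt_pow_right (by omega) (by omega)))
    have h₂ : ℓ ^ c + 1 ≤ ℓ ^ (c + 1) := by
      have h₃ : 0 < ℓ ^ c := by positivity
      have h₄ := Nat.mul_le_mul_left (ℓ ^ c) hℓ
      rw [pow_succ]
      omega
    have h₅ : 7 ≤ ℓ ^ 3 := le_trans (by norm_num) (Nat.pow_le_pow_left hℓ 3)
    rw [pow_add, pow_mul]
    exact Nat.mul_le_mul h₅ (Nat.pow_le_pow_left (h₁.trans h₂) 3)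
  refine (((QPComputable.const 7).mul ((hf.size.mul hf.size).mul hf.size)).fold (.const 1)
    (s := fun _ _ a => a * 2) (acc₂.mul (.const 2)) hb fun e i hi => ?_).of_eq fun e => ?_
  · rw [key]
    exact Nat.pow_le_pow_right (by omega) (hi.trans_eq (by ring))
  · rw [key, PTAutomata.searchBound]
    ring_nf

end QPComputable

namespace QPDecidable

/-- The quantifiers of `BoundedTest` are added one at a time in this and the next lemmas. -/
theorem agreeOn {k u v : E → ℕ} (hf : QPComputable args f) (hg : QPComputable args g)
    (hk : QPComputable args k) (hu : QPComputable args u) (hv : QPComputable args v) :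
    QPDecidable args fun e => ∀ Z < searchBound (g e), Z / (numLetters (f e) + 1) ^ k e = 0 →
      (remCode (numLetters (f e) + 1) Z (u e) = 0 ↔
        remCode (numLetters (f e) + 1) Z (v e) = 0) := by
  have hb := hf.numLetters.succ.lift
  exact forall_lt hg.searchBound (P := fun e Z =>
      Z / (numLetters (f e) + 1) ^ k e = 0 → (remCode (numLetters (f e) + 1) Z (u e) = 0 ↔
        remCode (numLetters (f e) + 1) Z (v e) = 0))
    (.imp (.eq_zero (.div_pow .idx hb hk.lift)) (.iff (.eq_zero (hb.remCode .idx hu.lift))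
      (.eq_zero (hb.remCode .idx hv.lift))))

theorem agreeOn_imp {k u v : E → ℕ} (hf : QPComputable args f) (hg : QPComputable args g)
    (hk : QPComputable args k) (hu : QPComputable args u) (hv : QPComputable args v) :
    QPDecidable args fun e => (∀ Z < searchBound (g e), Z / (numLetters (f e) + 1) ^ k e = 0 →
      (remCode (numLetters (f e) + 1) Z (u e) = 0 ↔
        remCode (numLetters (f e) + 1) Z (v e) = 0)) → runCode (f e) (u e) = runCode (f e) (v e) :=
  .imp (agreeOn hf hg hk hu hv) (.eq (hf.runCode hu) (hf.runCode hv))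

theorem forall_agreeOn_imp {k u : E → ℕ} (hf : QPComputable args f) (hg : QPComputable args g)
    (hk : QPComputable args k) (hu : QPComputable args u) :
    QPDecidable args fun e => ∀ V < searchBound (g e),
      (∀ Z < searchBound (g e), Z / (numLetters (f e) + 1) ^ k e = 0 →
        (remCode (numLetters (f e) + 1) Z (u e) = 0 ↔
          remCode (numLetters (f e) + 1) Z V = 0)) → runCode (f e) (u e) = runCode (f e) V :=
  forall_lt hg.searchBound (P := fun e V =>
    (∀ Z < searchBound (g e), Z / (numLetters (f e) + 1) ^ k e = 0 →
      (remCode (numLetters (f e) + 1) Z (u e) = 0 ↔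
        remCode (numLetters (f e) + 1) Z V = 0)) → runCode (f e) (u e) = runCode (f e) V)
    (agreeOn_imp hf.lift hg.lift hk.lift hu.lift .idx)

theorem boundedTest {k : E → ℕ} (hf : QPComputable args f) (hg : QPComputable args g)
    (hk : QPComputable args k) : QPDecidable args fun e => BoundedTest (f e) (g e) (k e) :=
  forall_lt hg.searchBound (P := fun e U => ∀ V < searchBound (g e),
    (∀ Z < searchBound (g e), Z / (numLetters (f e) + 1) ^ k e = 0 →
      (remCode (numLetters (f e) + 1) Z U = 0 ↔
        remCode (numLetters (f e) + 1) Z V = 0)) → runCode (f e) U = runCode (f e) V)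
    (forall_agreeOn_imp hf.lift hg.lift hk.lift .idx)

end QPDecidable

namespace QPComputable

theorem leastTest (hf : QPComputable args f) (hg : QPComputable args g) :
    QPComputable args fun e => leastTest (f e, g e) :=
  hg.searchBound.firstLt (P := fun e k => BoundedTest (f e) (g e) k)
    (.boundedTest hf.lift hg.lift idx)

end QPComputable

end Algorithm

end PTAutomata

/-- One fixed machine finds the least `k` for every minimal partially ordered confluent DFA with
`n` states and `m` letters, within `2 ^ poly(n + m) * 2 ^ 2 ^ O(k)` steps. -/
theorem mainTheorem11 :
    ∃ (T : Turing.TM2ComputableAux Bool Bool) (p : Polynomial ℕ) (c : ℕ),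
      ∀ (n m : ℕ) (_ : 0 < m) (M : DFA (Fin m) (Fin n)),
        PTAutomata.IsMinimal M → PTAutomata.IsPartiallyOrdered M → PTAutomata.IsConfluent M →
          ∃ k : ℕ,
            IsLeast {j : ℕ | PTAutomata.IsPiecewiseTestable j M.accepts} k ∧
            PTAutomata.HaltsWithOutput T (PTAutomata.codeDFA M) (Computability.unaryEncodeNat k)
              (2 ^ p.eval (n + m) * 2 ^ 2 ^ (c * k)) := by
  obtain ⟨T, c, hT⟩ := (PTAutomata.QPComputable.leastTest (f := Prod.fst) (g := Prod.snd)
    (.var (by simp)) (.var (by simp))).exists_machine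
  -- The machine is exponential in the length of the code, which is cubic in `n + m`; so the doubly
  -- exponential factor is not needed. The constant `4` covers the `+ 2` in `exists_machine`.
  refine ⟨T, (Polynomial.X ^ 3 + 3 * Polynomial.X + 4) ^ c, 0, fun n m hm M hmin hM hC => ?_⟩
  obtain ⟨k, hk, hleast⟩ := PTAutomata.exists_isLeast M hmin hM hC
  refine ⟨k, hleast, ?_⟩
  have h := hT (PTAutomata.codeDFA M)
  rw [PTAutomata.leastTest_eq M hm hmin hM hC hk hleast] at h
  refine h.map fun h => ⟨h.toEvalsTo, h.steps_le_m.trans ?_⟩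
  have hlen := PTAutomata.length_codeDFA_le M
  rw [Polynomial.eval_pow]
  refine (Nat.pow_le_pow_right (by omega) (Nat.pow_le_pow_left ?_ c)).trans
    (le_mul_of_one_le_right (Nat.zero_le _) Nat.one_le_two_pow)
  simp
  omega
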